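/- Let $\Gamma=(X,R)$ be a finite connected bipartite distance-regular graph with even diameter $D\ge 4$ and valency $k\ge 3$, path-length distance $\partial$, intersection numbers $p^h_{ij}=|\{z\in X:\partial(y,z)=i,\ \partial(z,w)=j\}|$ for $\partial(y,w)=h$, and abbreviations $b_i=p^i_{1,i+1}$, $c_i=p^i_{1,i-1}$, $k_i=p^0_{ii}$. For $0\le i\le D$ let $A_i\in \mathrm{Mat}_X(\mathbb C)$ be the $i$-th distance matrix, $A=A_1$, let $\theta_0>\theta_1>\cdots>\theta_D$ be the distinct eigenvalues of $A$, and let $E_i$ be the orthogonal projection of $\mathbb C^X$ onto the eigenspace of $A$ for $\theta_i$. Put $d=D/2$ and $\tilde\theta_d=-1-b_2b_3(\theta_d^2-b_2)^{-1}$. Fix $x\in X$, let $E^*_i$ be the diagonal matrix whose $(y,y)$ entry is $1$ if $\partial(x,y)=i$ and $0$ otherwise, and let $T$ be the subalgebra of $\mathrm{Mat}_X(\mathbb C)$ generated by $A,E^*_0,\dots,E^*_D$. A $T$-module means a $T$-invariant subspace of $\mathbb C^X$. Let the real polynomials $f_0,\dots,f_D$ be given by $f_{-1}=0$, $f_0=1$,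 $\lambda f_i=b_{i-1}f_{i-1}+c_{i+1}f_{i+1}$ $(0\le i\le D-1)$; let $p_i=f_i+f_{i-2}+f_{i-4}+\cdots$ (ending in $f_0$ or $f_1$); and let $P_i$ be the polynomial with $p_i(\lambda)=P_i(\lambda^2)$ for $i$ even and $p_i(\lambda)=\lambda P_i(\lambda^2)$ for $i$ odd. Let $W$ be an irreducible $T$-module that is thin ($\dim E^*_iW\le 1$ for $0\le i\le D$), has endpoint $2$ ($\min\{i: E^*_iW\ne 0\}=2$) and has local eigenvalue $\tilde\theta_d$ ($E^*_2A_2E^*_2$ acts on $E^*_2W$ as the scalar $\tilde\theta_d$). Let $v$ be a nonzero vector in $E^*_2W$. Then for $0\le i\le D-3$ the scalars $P_i(0)$ and $k_ib_ib_{i+1}$ are nonzero, and $$E^*_{i+2}A_iv=\sum_{\substack{1\le j\le D-1\\ j\ne d}} g_i(\theta_j)\,E_jv,\qquad\text{where}\qquad g_i=\sum_{\substack{0\le h\le i\\ i-h\text{ even}}}\frac{P_h(0)}{P_i(0)}\,\frac{k_ib_ib_{i+1}}{k_hb_hb_{h+1}}\,p_h .$$ Moreover the vectors $E_jv$ $(1\le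 j\le D-1,\ j\ne d)$ form a basis of $W$, the vectors $E^*_{i+2}A_iv$ $(0\le i\le D-3)$ form a basis of $W$, and the matrix expressing the second basis in terms of the first has entries $g_i(\theta_j)$. -/

import Mathlib

open scoped Matrix Polynomial

noncomputable section

namespace DRG

variable {X : Type*} [Fintype X]

/-! Distance-regular graphs and their intersection numbers. -/

/-- The number of vertices `z` with `∂(x,z) = i` and `∂(z,y) = j`. -/
def sphereInter (G : SimpleGraph X) (i j : ℕ) (x y : X) : ℕ :=
  (Finset.univ.filter fun z : X => G.dist x z = i ∧ G.dist z y = j).card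

/-- A finite connected graph is distance-regular when, for all `h, i, j`, the number of `z` with
`∂(x,z) = i` and `∂(z,y) = j` is the same for all pairs `x, y` with `∂(x,y) = h`. -/
structure IsDistanceRegular (G : SimpleGraph X) : Prop where
  connected : G.Connected
  regular : ∀ (h i j : ℕ) (x y x' y' : X), G.dist x y = h → G.dist x' y' = h →
    sphereInter G i j x y = sphereInter G i j x' y'

open Classical in
/-- The intersection number `p^h_{ij}` of a distance-regular graph, read off from some pair of
vertices at distance `h` (and `0` if there is no such pair). -/
def intersectionNumber (G : SimpleGraph X) (h i j : ℕ) : ℕ :=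
  if H : ∃ q : X × X, G.dist q.1 q.2 = h then sphereInter G i j H.choose.1 H.choose.2 else 0

theorem IsDistanceRegular.sphereInter_eq {G : SimpleGraph X} (hG : IsDistanceRegular G)
    (h i j : ℕ) (x y : X) (hxy : G.dist x y = h) :
    sphereInter G i j x y = intersectionNumber G h i j := by
  have H : ∃ q : X × X, G.dist q.1 q.2 = h := ⟨(x, y), hxy⟩
  rw [intersectionNumber, dif_pos H]
  exact hG.regular h i j x y _ _ hxy H.choose_spec

/-- `c_i = p^i_{1,i-1}` for `i ≥ 1`, and `c_0 = 0`. -/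
def c (G : SimpleGraph X) : ℕ → ℕ
  | 0 => 0
  | i + 1 => intersectionNumber G (i + 1) 1 i

/-- `b_i = p^i_{1,i+1}`; this is `0` for `i = D`. -/
def b (G : SimpleGraph X) (i : ℕ) : ℕ := intersectionNumber G i 1 (i + 1)

/-- `k_i = p^0_{ii}`, the number of vertices at distance `i` from a given vertex. -/
def kk (G : SimpleGraph X) (i : ℕ) : ℕ := intersectionNumber G 0 i i

/-! The polynomials. -/

/-- `f_0 = 1` and `λ f_i = b_{i-1} f_{i-1} + c_{i+1} f_{i+1}`, where `f_{-1} = 0`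
(the `c_i` are nonzero for `1 ≤ i ≤ D`). -/
def f (G : SimpleGraph X) : ℕ → ℝ[X]
  | 0 => 1
  | 1 => Polynomial.C (c G 1 : ℝ)⁻¹ * Polynomial.X
  | i + 2 => Polynomial.C (c G (i + 2) : ℝ)⁻¹ *
      (Polynomial.X * f G (i + 1) - Polynomial.C (b G i : ℝ) * f G i)

/-- The indices `h` with `0 ≤ h ≤ i` and `i - h` even. -/
def sameParity (i : ℕ) : Finset ℕ := (Finset.range (i + 1)).filter fun h => Even (i - h)

/-- `p_i = f_i + f_{i-2} + f_{i-4} + ⋯`, ending in `f_0` or `f_1`. -/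
def p (G : SimpleGraph X) (i : ℕ) : ℝ[X] := ∑ h ∈ sameParity i, f G h

/-- The polynomial `P_i` with `p_i(λ) = P_i(λ²)` for even `i` and `p_i(λ) = λ P_i(λ²)` for odd `i`
(see `p_eq`). -/
def P (G : SimpleGraph X) (i : ℕ) : ℝ[X] :=
  Polynomial.contract 2 (if Even i then p G i else (p G i).divX)

theorem f_coeff (G : SimpleGraph X) (i n : ℕ) (h : ¬ Even (n + i)) : (f G i).coeff n = 0 := by
  induction i using Nat.strong_induction_on generalizing n with
  | _ i ih =>
    match i, ih with
    | 0, _ =>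
      have : n ≠ 0 := by rintro rfl; simp at h
      simp [f, Polynomial.coeff_one, this]
    | 1, _ =>
      have : 1 ≠ n := by rintro rfl; simp at h
      simp [f, Polynomial.coeff_X, this]
    | i + 2, ih =>
      have h2 : (f G i).coeff n = 0 := ih i (by omega) n (by grind)
      rw [f, Polynomial.coeff_C_mul, Polynomial.coeff_sub, Polynomial.coeff_C_mul, h2]
      cases n with
      | zero => simp
      | succ n => simp [ih (i + 1) (by omega) n (by grind)]

theorem p_coeff (G : SimpleGraph X) (i n : ℕ) (h : ¬ Even (n + i)) : (p G i).coeff n = 0 := by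
  rw [p, Polynomial.finsetSum_coeff]
  refine Finset.sum_eq_zero fun j hj => f_coeff G j n ?_
  simp only [sameParity, Finset.mem_filter, Finset.mem_range] at hj
  grind

theorem p_eq (G : SimpleGraph X) (i : ℕ) :
    p G i = if Even i then (P G i).comp (Polynomial.X ^ 2)
      else Polynomial.X * (P G i).comp (Polynomial.X ^ 2) := by
  rw [← Polynomial.expand_eq_comp_X_pow]
  ext n
  by_cases hi : Even i
  · simp only [hi, if_true, P, Polynomial.coeff_expand two_pos,
      Polynomial.coeff_contract two_ne_zero]
    split_ifs with hn
    · rw [Nat.div_mul_cancel hn]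
    · exact p_coeff G i n (by grind)
  · simp only [hi, if_false, P]
    cases n with
    | zero => simpa using p_coeff G i 0 (by simpa using hi)
    | succ n =>
      rw [Polynomial.coeff_X_mul, Polynomial.coeff_expand two_pos]
      split_ifs with hn
      · rw [Polynomial.coeff_contract two_ne_zero, Nat.div_mul_cancel hn, Polynomial.coeff_divX]
      · exact p_coeff G i (n + 1) (by grind)

/-- The polynomial `g_i`: the sum over `0 ≤ h ≤ i` with `i - h` even of
`(P_h(0) / P_i(0)) (k_i b_i b_{i+1} / (k_h b_h b_{h+1})) p_h`. -/
def g (G : SimpleGraph X) (i : ℕ) : ℝ[X] :=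
  ∑ h ∈ sameParity i,
    Polynomial.C (((P G h).eval 0 / (P G i).eval 0) *
      (((kk G i : ℝ) * b G i * b G (i + 1)) / ((kk G h : ℝ) * b G h * b G (h + 1)))) * p G h

/-! The distance matrices, the eigenvalues and the primitive idempotents. -/

/-- The `i`-th distance matrix `A_i`; the adjacency matrix is `A = A_1`. -/
def distMatrix {Y : Type*} (G : SimpleGraph Y) (i : ℕ) : Matrix Y Y ℂ :=
  Matrix.of fun y z => if G.dist y z = i then 1 else 0

theorem distMatrix_isHermitian {Y : Type*} (G : SimpleGraph Y) (i : ℕ) :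
    (distMatrix G i).IsHermitian := by
  ext y z
  simp only [distMatrix, Matrix.conjTranspose_apply, Matrix.of_apply, G.dist_comm (u := z)]
  split_ifs <;> simp

variable [DecidableEq X]

/-- The list of the distinct (real) eigenvalues of `A`, in decreasing order. -/
def eigenvalueList (G : SimpleGraph X) : List ℝ :=
  (Finset.univ.image (distMatrix_isHermitian G 1).eigenvalues).sort (· ≥ ·)

/-- The eigenvalue `θ_i`, where `θ_0 > θ_1 > ... > θ_D` are the distinct eigenvalues of `A`. -/
def theta (G : SimpleGraph X) (i : ℕ) : ℝ := (eigenvalueList G).getD i 0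

/-- The primitive idempotent `E_i`: the matrix of the orthogonal projection of `ℂ^X` (with its
Hermitian inner product) onto the eigenspace of `A` for `θ_i`. -/
def primIdem (G : SimpleGraph X) (i : ℕ) : Matrix X X ℂ :=
  (Matrix.toEuclideanCLM (n := X) (𝕜 := ℂ)).symm
    (Module.End.eigenspace (Matrix.toEuclideanLin (distMatrix G 1))
      ((theta G i : ℝ) : ℂ)).starProjection

/-! The subconstituent algebra `T(x)` and its modules in the standard module `ℂ^X`. -/

/-- The dual idempotent `E*_i = E*_i(x)`. -/
def dualIdem (G : SimpleGraph X) (x : X) (i : ℕ) : Matrix X X ℂ :=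
  Matrix.diagonal fun y => if G.dist x y = i then 1 else 0

/-- The subconstituent algebra `T = T(x)`, generated by `A` and the `E*_i`
(note `E*_i = 0` for `i > D`). -/
def subconstituentAlgebra (G : SimpleGraph X) (x : X) : Subalgebra ℂ (Matrix X X ℂ) :=
  Algebra.adjoin ℂ (insert (distMatrix G 1) (Set.range (dualIdem G x)))

/-- A `T`-module: a subspace of `ℂ^X` invariant under `T`. -/
def IsTModule (G : SimpleGraph X) (x : X) (W : Submodule ℂ (X → ℂ)) : Prop :=
  ∀ B ∈ subconstituentAlgebra G x, ∀ w ∈ W, B *ᵥ w ∈ W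

/-- An irreducible `T`-module. -/
structure IsIrredTModule (G : SimpleGraph X) (x : X) (W : Submodule ℂ (X → ℂ)) : Prop where
  isTModule : IsTModule G x W
  ne_bot : W ≠ ⊥
  eq_bot_or_eq : ∀ W' : Submodule ℂ (X → ℂ), IsTModule G x W' → W' ≤ W → W' = ⊥ ∨ W' = W

/-- The subspace `E*_i W`. -/
def dualComponent (G : SimpleGraph X) (x : X) (W : Submodule ℂ (X → ℂ)) (i : ℕ) :
    Submodule ℂ (X → ℂ) :=
  W.map (dualIdem G x i).mulVecLin

/-- `W` is thin: `dim E*_i W ≤ 1` for `0 ≤ i ≤ D`. -/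
def IsThin (G : SimpleGraph X) (x : X) (W : Submodule ℂ (X → ℂ)) : Prop :=
  ∀ i ≤ G.diam, Module.finrank ℂ (dualComponent G x W i) ≤ 1

/-- The endpoint `min {i | 0 ≤ i ≤ D, E*_i W ≠ 0}`. -/
def endpoint (G : SimpleGraph X) (x : X) (W : Submodule ℂ (X → ℂ)) : ℕ :=
  sInf {i | i ≤ G.diam ∧ dualComponent G x W i ≠ ⊥}

/-- For a thin irreducible `T`-module `W` with endpoint 2: `η` is the local eigenvalue of `W`, i.e.
`E*_2 A_2 E*_2` acts on (the nonzero space) `E*_2 W` as the scalar `η`. -/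
def HasLocalEigenvalue (G : SimpleGraph X) (x : X) (W : Submodule ℂ (X → ℂ)) (η : ℝ) : Prop :=
  ∀ w ∈ dualComponent G x W 2,
    (dualIdem G x 2 * distMatrix G 2 * dualIdem G x 2) *ᵥ w = (η : ℂ) • w

/-- `z̃ = -1 - b_2 b_3 / (z² - b_2)`, for real `z` with `z² ≠ b_2`. -/
def tilde (G : SimpleGraph X) (z : ℝ) : ℝ :=
  -1 - ((b G 2 : ℝ) * b G 3) / (z ^ 2 - b G 2)

end DRG

end

namespace DRG

/-! ### Parity of distances and counting identities for intersection numbers. -/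

section Combinatorics

variable {X : Type*} {G : SimpleGraph X}

/-! Since D = 2d and the spectrum of a bipartite graph is symmetric about 0, θ_d = 0, so the local
eigenvalue is b_3 - 1. Write r_i = E*_{i+2} A_i v (`raised`) and s_i = E*_i A_{i+2} v (`capped`).
Endpoint 2 gives E*_0 A_2 v = 0, so the entries of v sum to 0, and E*_1 A v = 0. As p_i(A) is the
sum of the A_h with h ≤ i and h ≡ i mod 2, and v lives on the sphere of radius 2, this zero sum
yields p_i(A) v = r_i - s_i (`act_p_eq`).

Because b_j + c_j = k, the p_i satisfy λ p_{i+1} = c_{i+2} p_{i+2} + b_{i+2} p_i (`X_mul_p`).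
Applying this to v and cutting by spheres gives relations between r and s. Thinness makes s_{i+2} a
multiple of r_i; the local eigenvalue fixes the first multiple, s_2 = -b_3 v, and the relations
force all later ones, as well as the coefficient of r_i in A r_{i+1} (`IsLocalVector.scalars`).
These are `upperScalar` and `lowerScalar`, explicit in the numbers P_i(0). Thus r_{i+2} = p_{i+2}(A)
v + s_{i+2} is the recursion defining g_i, and r_i = g_i(A) v (`IsLocalVector.raised_eq_act_g`).

It remains to expand v in eigenvectors. The lower scalars are nonzero for i < D - 3 but vanish at i
= D - 3, where D even brings in a factor b_D = 0. Hence r_0, ..., r_{D-3} are nonzero, while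
self-adjointness of A forces r_{D-2} = 0. The chain then solves backwards, putting v = r_0 in the
image of A, so E_d v = 0. Also p_D(A) v = 0 and p_D(±k) > 0, so E_0 v = E_D v = 0. Only the D - 2
components with j ≠ 0, d, D remain.

Finally, the r_i with i ≤ D - 3 lie on distinct spheres, so they are independent, and their span is
invariant under A and all E*_n; irreducibility makes it W. The D - 2 vectors E_j v span a space
containing W, so by dimension they too form a basis. -/

theorem exists_coloring (hG : G.Connected) (hb : G.IsBipartite) :
    ∃ col : X → Bool, ∀ x y, Even (G.dist x y) ↔ (col x ↔ col y) := by
  obtain ⟨C⟩ := hb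
  let C' : G.Coloring Bool :=
    SimpleGraph.Coloring.mk (fun x => finTwoEquiv (C x))
      (fun {a b} h h' => C.valid h (by simpa using h'))
  refine ⟨C', fun x y => ?_⟩
  obtain ⟨w, hw⟩ := hG.exists_walk_length_eq_dist x y
  rw [← hw]
  exact C'.even_length_iff_congr w

/-- A two-colouring makes distance parity additive. All uses of bipartiteness below come down to
this parity rule. -/
theorem even_dist_add (hG : G.Connected) (hb : G.IsBipartite) (x y z : X) :
    Even (G.dist x y + G.dist y z + G.dist x z) := by
  obtain ⟨col, h⟩ := exists_coloring hG hb
  have h1 := h x y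
  have h2 := h y z
  have h3 := h x z
  rw [Nat.even_add, Nat.even_add, h1, h2, h3]
  tauto

theorem exists_neighbor_dist (hG : G.Connected) {x y : X} {n : ℕ} (h : G.dist x y = n + 1) :
    ∃ z, G.dist x z = 1 ∧ G.dist z y = n := by
  obtain ⟨w, hw⟩ := hG.exists_walk_length_eq_dist x y
  rw [h] at hw
  cases w with
  | nil => simp at hw
  | @cons _ z _ ha w' =>
    simp only [SimpleGraph.Walk.length_cons, add_left_inj] at hw
    have h1 := SimpleGraph.dist_le w'
    have h2 : G.dist x z = 1 := SimpleGraph.dist_eq_one_iff_adj.2 ha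
    have h3 := hG.dist_triangle (u := x) (v := z) (w := y)
    exact ⟨z, h2, by omega⟩

theorem distMatrix_zero [DecidableEq X] (hG : G.Connected) : distMatrix G 0 = 1 := by
  ext y z
  simp [distMatrix, Matrix.one_apply, hG.dist_eq_zero_iff]

theorem exists_dist_eq (hG : G.Connected) {i : ℕ} (hi : i ≤ G.diam) :
    ∃ x y, G.dist x y = i := by
  have := hG.nonempty
  obtain ⟨x, y, hxy⟩ := SimpleGraph.exists_dist_eq_diam (G := G)
  have key : ∀ n, n ≤ G.diam → ∃ x, G.dist x y = G.diam - n := by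
    intro n
    induction n with
    | zero => exact fun _ => ⟨x, hxy⟩
    | succ n ih =>
      intro hn
      obtain ⟨z, hz⟩ := ih (by omega)
      obtain ⟨w, -, hw⟩ := exists_neighbor_dist hG (n := G.diam - (n + 1)) (hz.trans (by omega))
      exact ⟨w, hw⟩
  obtain ⟨z, hz⟩ := key (G.diam - i) (by omega)
  exact ⟨z, y, hz.trans (by omega)⟩

variable [Fintype X]

theorem dist_le_of_diam (hG : G.Connected) (x y : X) : G.dist x y ≤ G.diam := by
  have : Nonempty X := ⟨x⟩
  exact SimpleGraph.dist_le_diam (SimpleGraph.connected_iff_ediam_ne_top.1 hG)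

theorem intersectionNumber_eq_zero {h i j : ℕ} (hh : ∀ x y, G.dist x y ≠ h) :
    intersectionNumber G h i j = 0 := by
  rw [intersectionNumber, dif_neg]
  rintro ⟨q, hq⟩
  exact hh _ _ hq

theorem b_eq_zero (hG : G.Connected) {i : ℕ} (hi : G.diam ≤ i) (hr : IsDistanceRegular G) :
    b G i = 0 := by
  by_cases H : ∃ q : X × X, G.dist q.1 q.2 = i
  · obtain ⟨⟨x, y⟩, h⟩ := H
    rw [b, ← hr.sphereInter_eq i 1 (i + 1) x y h, sphereInter, Finset.card_eq_zero,
      Finset.filter_eq_empty_iff]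
    rintro z - ⟨-, hz⟩
    have := dist_le_of_diam hG z y
    omega
  · exact intersectionNumber_eq_zero fun x y h => H ⟨(x, y), h⟩

theorem c_pos (hr : IsDistanceRegular G) {i : ℕ} (hi : i + 1 ≤ G.diam) : 0 < c G (i + 1) := by
  obtain ⟨x, y, h⟩ := exists_dist_eq hr.connected hi
  obtain ⟨z, hz⟩ := exists_neighbor_dist hr.connected h
  rw [c, ← hr.sphereInter_eq _ _ _ x y h, sphereInter, Finset.card_pos]
  exact ⟨z, by simpa using hz⟩

theorem b_pos (hr : IsDistanceRegular G) {i : ℕ} (hi : i < G.diam) : 0 < b G i := by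
  obtain ⟨x, y, h⟩ := exists_dist_eq hr.connected (i := i + 1) hi
  obtain ⟨z, hz, hz'⟩ := exists_neighbor_dist hr.connected h
  rw [b, ← hr.sphereInter_eq _ _ _ z y hz', sphereInter, Finset.card_pos]
  exact ⟨x, by simpa [SimpleGraph.dist_comm (u := z), hz] using h⟩

theorem c_one (hr : IsDistanceRegular G) (hD : 1 ≤ G.diam) : c G 1 = 1 := by
  obtain ⟨x, y, h⟩ := exists_dist_eq hr.connected hD
  rw [c, ← hr.sphereInter_eq _ _ _ x y h, sphereInter, Finset.card_eq_one]
  refine ⟨y, ?_⟩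
  ext z
  simp only [Finset.mem_filter, Finset.mem_univ, true_and, Finset.mem_singleton,
    hr.connected.dist_eq_zero_iff]
  constructor
  · exact fun h => h.2
  · rintro rfl; exact ⟨h, rfl⟩

theorem card_sphere (hr : IsDistanceRegular G) (x : X) (i : ℕ) :
    (Finset.univ.filter fun z => G.dist x z = i).card = kk G i := by
  rw [kk, ← hr.sphereInter_eq 0 i i x x (by simp), sphereInter]
  congr 1
  ext z
  simp [SimpleGraph.dist_comm (u := z)]

theorem card_neighbors (hr : IsDistanceRegular G) (x : X) :
    (Finset.univ.filter fun z => G.dist x z = 1).card = b G 0 := by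
  rw [b, ← hr.sphereInter_eq 0 1 1 x x (by simp), sphereInter]
  congr 1
  ext z
  simp [SimpleGraph.dist_comm (u := z)]

/-- By parity a neighbour of x cannot be at the same distance from y as x, so every neighbour is one
step nearer or one step farther. -/
theorem b_add_c (hr : IsDistanceRegular G) (hb : G.IsBipartite) {i : ℕ} (hi : i ≤ G.diam) :
    b G i + c G i = b G 0 := by
  classical
  obtain ⟨x, y, h⟩ := exists_dist_eq hr.connected hi
  cases i with
  | zero => simp [c]
  | succ i =>
    rw [← card_neighbors hr x, b, c, ← hr.sphereInter_eq _ _ _ x y h,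
      ← hr.sphereInter_eq _ _ _ x y h, sphereInter, sphereInter, ← Finset.card_union_of_disjoint]
    · congr 1
      ext z
      simp only [Finset.mem_union, Finset.mem_filter, Finset.mem_univ, true_and]
      have h1 := even_dist_add hr.connected hb x z y
      have h2 := hr.connected.dist_triangle (u := x) (v := z) (w := y)
      have h3 := hr.connected.dist_triangle (u := z) (v := x) (w := y)
      rw [SimpleGraph.dist_comm (u := z) (v := x)] at h3
      constructor
      · tauto
      · intro h4
        rw [h4, h] at h1 h2 h3
        have : G.dist z y ≠ i + 1 := by
          intro h5
          rw [h5] at h1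
          revert h1
          grind
        omega
    · rw [Finset.disjoint_filter]
      omega

theorem distMatrix_eq_zero (hG : G.Connected) {i : ℕ} (hi : G.diam < i) : distMatrix G i = 0 := by
  ext y z
  have := dist_le_of_diam hG y z
  simp only [distMatrix, Matrix.of_apply, Matrix.zero_apply, ite_eq_right_iff]
  omega

theorem distMatrix_one_mul_apply (hr : IsDistanceRegular G) (i : ℕ) (y z : X) :
    (distMatrix G 1 * distMatrix G i) y z = intersectionNumber G (G.dist y z) 1 i := by
  rw [← hr.sphereInter_eq _ _ _ y z rfl]
  simp only [Matrix.mul_apply, distMatrix, Matrix.of_apply, sphereInter, ← ite_and, mul_ite,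
    mul_one, mul_zero]
  rw [← Finset.sum_boole]
  refine Finset.sum_congr rfl fun w _ => ?_
  congr 1
  rw [eq_iff_iff]
  tauto

theorem intersectionNumber_one_eq_zero (hr : IsDistanceRegular G) (hb : G.IsBipartite) {h i : ℕ}
    (h1 : h ≠ i + 1) (h2 : i ≠ h + 1) : intersectionNumber G h 1 i = 0 := by
  by_cases H : ∃ q : X × X, G.dist q.1 q.2 = h
  · obtain ⟨⟨x, y⟩, h⟩ := H
    rw [← hr.sphereInter_eq _ _ _ x y h, sphereInter, Finset.card_eq_zero,
      Finset.filter_eq_empty_iff]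
    rintro z - ⟨h3, hz⟩
    have h5 := even_dist_add hr.connected hb x z y
    have h6 := hr.connected.dist_triangle (u := x) (v := z) (w := y)
    have h7 := hr.connected.dist_triangle (u := z) (v := x) (w := y)
    rw [SimpleGraph.dist_comm (u := z) (v := x)] at h7
    simp only at h
    rw [h3, hz, h] at h5 h6 h7
    grind
  · exact intersectionNumber_eq_zero fun x y h => H ⟨(x, y), h⟩

/-- No bound on i is needed: distance matrices beyond the diameter are 0. -/
theorem distMatrix_one_mul (hr : IsDistanceRegular G) (hb : G.IsBipartite) (i : ℕ) :
    distMatrix G 1 * distMatrix G (i + 1) =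
      (b G i : ℂ) • distMatrix G i + (c G (i + 2) : ℂ) • distMatrix G (i + 2) := by
  ext y z
  rw [distMatrix_one_mul_apply hr]
  simp only [Matrix.add_apply, Matrix.smul_apply, distMatrix, Matrix.of_apply, smul_eq_mul,
    mul_ite, mul_one, mul_zero]
  by_cases h1 : G.dist y z = i
  · simp [h1, b]
  · by_cases h2 : G.dist y z = i + 2
    · simp [h2, c]
    · rw [intersectionNumber_one_eq_zero hr hb (by omega) (by omega)]
      simp [h1, h2]

/-- Double counting of the edges between two consecutive spheres around a vertex. -/
theorem b_mul_kk (hr : IsDistanceRegular G) (i : ℕ) :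
    b G i * kk G i = c G (i + 1) * kk G (i + 1) := by
  obtain ⟨x⟩ := hr.connected.nonempty
  rw [← card_sphere hr x i, ← card_sphere hr x (i + 1), mul_comm, mul_comm (c G (i + 1))]
  refine Finset.card_mul_eq_card_mul (fun y z => G.dist y z = 1) ?_ ?_
  · intro y hy
    simp only [Finset.mem_filter, Finset.mem_univ, true_and] at hy
    rw [b, ← hr.sphereInter_eq i 1 (i + 1) y x (by rw [SimpleGraph.dist_comm, hy]), sphereInter]
    congr 1
    ext z
    simp [Finset.mem_bipartiteAbove, SimpleGraph.dist_comm (u := x)]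
    tauto
  · intro y hy
    simp only [Finset.mem_filter, Finset.mem_univ, true_and] at hy
    rw [c, ← hr.sphereInter_eq (i + 1) 1 i y x (by rw [SimpleGraph.dist_comm, hy]), sphereInter]
    congr 1
    ext z
    simp [Finset.mem_bipartiteBelow, SimpleGraph.dist_comm (u := x),
      SimpleGraph.dist_comm (u := z) (v := y)]
    tauto

theorem kk_zero (hr : IsDistanceRegular G) : kk G 0 = 1 := by
  obtain ⟨x⟩ := hr.connected.nonempty
  rw [← card_sphere hr x 0, Finset.card_eq_one]
  refine ⟨x, ?_⟩
  ext z
  simp [hr.connected.dist_eq_zero_iff, eq_comm]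

theorem kk_pos (hr : IsDistanceRegular G) {i : ℕ} (hi : i ≤ G.diam) : 0 < kk G i := by
  induction i with
  | zero => simp [kk_zero hr]
  | succ i ih =>
    have h1 := Nat.mul_pos (b_pos hr (i := i) (by omega)) (ih (by omega))
    rw [b_mul_kk hr] at h1
    exact Nat.pos_of_mul_pos_left h1

end Combinatorics

/-! ### The polynomials p_i and the values P_i(0). -/

section Polynomials

variable {X : Type*} [Fintype X] {G : SimpleGraph X}

/-- The bound on i is essential: c_{D+1} = 0, whose inverse is 0 by convention, so the recursion for
f_{D+1} fails. -/
theorem c_mul_f (hr : IsDistanceRegular G) {i : ℕ} (hi : i + 2 ≤ G.diam) :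
    Polynomial.C (c G (i + 2) : ℝ) * f G (i + 2) =
      Polynomial.X * f G (i + 1) - Polynomial.C (b G i : ℝ) * f G i := by
  have h : (c G (i + 2) : ℝ) ≠ 0 := by exact_mod_cast (c_pos hr (i := i + 1) hi).ne'
  rw [f, ← mul_assoc, ← Polynomial.C_mul, mul_inv_cancel₀ h, Polynomial.C_1, one_mul]

theorem f_one (hr : IsDistanceRegular G) (hD : 1 ≤ G.diam) : f G 1 = Polynomial.X := by
  simp [f, c_one hr hD]

theorem sameParity_add_two (i : ℕ) : sameParity (i + 2) = insert (i + 2) (sameParity i) := by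
  ext h
  simp only [sameParity, Finset.mem_filter, Finset.mem_range, Finset.mem_insert]
  constructor
  · rintro ⟨h1, h2⟩
    by_cases h3 : h = i + 2
    · exact Or.inl h3
    · have h4 : h ≠ i + 1 := by
        rintro rfl
        rw [show i + 2 - (i + 1) = 1 by omega] at h2
        simp at h2
      refine Or.inr ⟨by omega, ?_⟩
      rw [show i + 2 - h = i - h + 2 by omega] at h2
      simpa [Nat.even_add] using h2
  · rintro (rfl | ⟨h1, h2⟩)
    · simp
    · refine ⟨by omega, ?_⟩
      rw [show i + 2 - h = i - h + 2 by omega]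
      simpa [Nat.even_add] using h2

theorem notMem_sameParity (i : ℕ) : i + 2 ∉ sameParity i := by
  simp [sameParity]

theorem sameParity_zero : sameParity 0 = {0} := by decide

theorem sameParity_one : sameParity 1 = {1} := by decide

theorem p_zero : p G 0 = 1 := by simp [p, sameParity_zero, f]

theorem p_one (hr : IsDistanceRegular G) (hD : 1 ≤ G.diam) : p G 1 = Polynomial.X := by
  simp [p, sameParity_one, f_one hr hD]

theorem p_add_two (i : ℕ) : p G (i + 2) = f G (i + 2) + p G i := by
  rw [p, sameParity_add_two, Finset.sum_insert (notMem_sameParity i), p]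

/-- The recurrence of the f_i passes to the partial sums p_i because b_j + c_j is constant: the
terms created by summation telescope. -/
theorem X_mul_p (hr : IsDistanceRegular G) (hb : G.IsBipartite) {i : ℕ} (hi : i + 2 ≤ G.diam) :
    Polynomial.X * p G (i + 1) = Polynomial.C (c G (i + 2) : ℝ) * p G (i + 2) +
      Polynomial.C (b G (i + 2) : ℝ) * p G i := by
  have hbc : ∀ j, j ≤ G.diam → Polynomial.C (b G j : ℝ) + Polynomial.C (c G j : ℝ) =
      Polynomial.C (b G 0 : ℝ) := by
    intro j hj
    rw [← b_add_c hr hb hj]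
    simp
  induction i using Nat.twoStepInduction with
  | zero =>
    rw [p_add_two, p_one hr (by omega), p_zero, mul_add, c_mul_f hr hi, f_one hr (by omega), f]
    linear_combination -hbc 2 (by omega)
  | one =>
    have h1 := c_mul_f hr hi
    have h2 := c_mul_f hr (i := 0) (by omega)
    rw [f_one hr (by omega), f] at h2
    rw [p_add_two, p_add_two, p_one hr (by omega), p_zero, mul_add, mul_add, h1, f_one hr (by omega)]
    have h3 := hbc 1 (by omega)
    have h4 : Polynomial.C (c G 1 : ℝ) = 1 := by simp [c_one hr (by omega)]
    linear_combination (Polynomial.X : ℝ[X]) * (h3 - h4 - hbc 3 (by omega))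
  | more i ih _ =>
    have h1 := ih (by omega)
    have h2 := c_mul_f hr hi
    have h3 := hbc (i + 2) (by omega)
    have h4 := hbc (i + 4) (by omega)
    rw [show i + 2 + 1 = i + 1 + 2 by ring, p_add_two (i + 1), p_add_two (i + 2), mul_add, h1]
    rw [p_add_two i] at *
    linear_combination -h2 + (f G (i + 2) + p G i) * (h3 - h4)

/-- P_i(0) is the lowest coefficient of p_i that parity allows: the constant one for even i, the
linear one for odd i. This turns `X_mul_p` into recurrences for P_i(0). -/
theorem P_eval_zero (i : ℕ) : (P G i).eval 0 = (p G i).coeff (i % 2) := by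
  rw [← Polynomial.coeff_zero_eq_eval_zero, P, Polynomial.coeff_contract two_ne_zero]
  by_cases h : Even i
  · simp [h, Nat.even_iff.1 h]
  · simp [h, Nat.not_even_iff.1 h]

theorem P_eval_zero_even (hr : IsDistanceRegular G) (hb : G.IsBipartite) {i : ℕ}
    (hi : i + 2 ≤ G.diam) (h : Even i) :
    (c G (i + 2) : ℝ) * (P G (i + 2)).eval 0 = -(b G (i + 2) * (P G i).eval 0) := by
  have h1 := congrArg (fun q => q.coeff 0) (X_mul_p hr hb hi)
  simp only [P_eval_zero, Nat.add_mod_right, Nat.even_iff.1 h]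
  simp at h1
  linarith

theorem P_eval_zero_odd (hr : IsDistanceRegular G) (hb : G.IsBipartite) {i : ℕ}
    (hi : i + 2 ≤ G.diam) (h : Odd i) :
    (c G (i + 2) : ℝ) * (P G (i + 2)).eval 0 =
      (P G (i + 1)).eval 0 - b G (i + 2) * (P G i).eval 0 := by
  have h1 := congrArg (fun q => q.coeff 1) (X_mul_p hr hb hi)
  simp only [P_eval_zero, Nat.add_mod_right, Nat.odd_iff.1 h, Nat.even_iff.1 h.add_one]
  simp at h1
  linarith

theorem P_zero_eval_zero : (P G 0).eval 0 = 1 := by simp [P_eval_zero, p_zero]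

theorem P_one_eval_zero (hr : IsDistanceRegular G) (hD : 1 ≤ G.diam) : (P G 1).eval 0 = 1 := by
  simp [P_eval_zero, p_one hr hD]

/-- Signs alternate in steps of two: the even recurrence multiplies by a negative number, and in the
odd one both terms on the right carry the same sign. Strictness stops below D because b_D = 0. -/
theorem P_eval_zero_sign (hr : IsDistanceRegular G) (hb : G.IsBipartite) (m : ℕ) :
    (2 * m < G.diam → 0 < (-1 : ℝ) ^ m * (P G (2 * m)).eval 0) ∧
      (2 * m + 1 < G.diam → 0 < (-1 : ℝ) ^ m * (P G (2 * m + 1)).eval 0) := by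
  induction m with
  | zero =>
    refine ⟨fun _ => by simp [P_zero_eval_zero], fun h => ?_⟩
    simp at h
    simp [P_one_eval_zero hr (by omega)]
  | succ m ih =>
    have key : 2 * (m + 1) < G.diam → 0 < (-1 : ℝ) ^ (m + 1) * (P G (2 * (m + 1))).eval 0 := by
      intro h
      have h1 := ih.1 (by omega)
      have h2 := P_eval_zero_even hr hb (i := 2 * m) (by omega) (by simp)
      have h3 : (0 : ℝ) < c G (2 * m + 2) := by exact_mod_cast c_pos hr (i := 2 * m + 1) (by omega)
      have h4 : (0 : ℝ) < b G (2 * m + 2) := by exact_mod_cast b_pos hr (by omega)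
      refine pos_of_mul_pos_right (?_ : 0 < (c G (2 * m + 2) : ℝ) * _) h3.le
      rw [show 2 * (m + 1) = 2 * m + 2 by ring]
      have : (c G (2 * m + 2) : ℝ) * ((-1) ^ (m + 1) * (P G (2 * m + 2)).eval 0) =
          b G (2 * m + 2) * ((-1) ^ m * (P G (2 * m)).eval 0) := by
        linear_combination (-1) ^ (m + 1) * h2
      rw [this]
      positivity
    refine ⟨key, fun h => ?_⟩
    have h1 := ih.2 (by omega)
    have h0 := key (by omega)
    have h2 := P_eval_zero_odd hr hb (i := 2 * m + 1) (by omega) (by simp)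
    have h3 : (0 : ℝ) < c G (2 * m + 1 + 2) := by
      exact_mod_cast c_pos hr (i := 2 * m + 2) (by omega)
    have h4 : (0 : ℝ) < b G (2 * m + 1 + 2) := by exact_mod_cast b_pos hr (by omega)
    refine pos_of_mul_pos_right (?_ : 0 < (c G (2 * m + 1 + 2) : ℝ) * _) h3.le
    rw [show 2 * (m + 1) + 1 = 2 * m + 1 + 2 by ring]
    rw [show 2 * (m + 1) = 2 * m + 1 + 1 by ring] at h0
    have : (c G (2 * m + 1 + 2) : ℝ) * ((-1) ^ (m + 1) * (P G (2 * m + 1 + 2)).eval 0) =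
        (-1) ^ (m + 1) * (P G (2 * m + 1 + 1)).eval 0 +
        b G (2 * m + 1 + 2) * ((-1) ^ m * (P G (2 * m + 1)).eval 0) := by
      linear_combination (-1) ^ (m + 1) * h2
    rw [this]
    positivity

theorem P_eval_zero_ne_zero (hr : IsDistanceRegular G) (hb : G.IsBipartite) {i : ℕ}
    (hi : i < G.diam) : (P G i).eval 0 ≠ 0 := by
  intro h
  obtain ⟨m, rfl | rfl⟩ := Nat.even_or_odd' i
  · simpa [h] using (P_eval_zero_sign hr hb m).1 hi
  · simpa [h] using (P_eval_zero_sign hr hb m).2 hi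

theorem f_eval_valency (hr : IsDistanceRegular G) (hb : G.IsBipartite) {i : ℕ}
    (hi : i ≤ G.diam) : (f G i).eval (b G 0 : ℝ) = kk G i := by
  induction i using Nat.twoStepInduction with
  | zero => simp [f, kk_zero hr]
  | one =>
    have h := b_mul_kk hr 0
    simp only [kk_zero hr, c_one hr hi] at h
    simp only [f_one hr hi, Polynomial.eval_X]
    exact_mod_cast (by simpa using h : b G 0 = kk G 1)
  | more i ih1 ih2 =>
    have h := congrArg (Polynomial.eval (b G 0 : ℝ)) (c_mul_f hr hi)
    simp [ih1 (by omega), ih2 (by omega)] at h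
    have h1 : (b G (i + 1) : ℝ) * kk G (i + 1) = c G (i + 2) * kk G (i + 2) := by
      exact_mod_cast b_mul_kk hr (i + 1)
    have h2 : (b G i : ℝ) * kk G i = c G (i + 1) * kk G (i + 1) := by
      exact_mod_cast b_mul_kk hr i
    have h3 : (b G (i + 1) : ℝ) + c G (i + 1) = b G 0 := by
      exact_mod_cast b_add_c hr hb (by omega)
    have h4 : (c G (i + 2) : ℝ) ≠ 0 := by exact_mod_cast (c_pos hr (i := i + 1) hi).ne'
    refine mul_left_cancel₀ h4 ?_
    linear_combination h - h2 - kk G (i + 1) * h3 + h1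

/-- At k each f_h takes the value k_h, so p_i(k) is a sum of sphere sizes. -/
theorem p_eval_valency_pos (hr : IsDistanceRegular G) (hb : G.IsBipartite) {i : ℕ}
    (hi : i ≤ G.diam) : 0 < (p G i).eval (b G 0 : ℝ) := by
  rw [p, Polynomial.eval_finsetSum]
  have h : ∀ h ∈ sameParity i, h ≤ i := by
    intro h hh
    simp [sameParity] at hh
    omega
  refine Finset.sum_pos (fun j hj => ?_) ⟨i, by simp [sameParity]⟩
  rw [f_eval_valency hr hb ((h j hj).trans hi)]
  exact_mod_cast kk_pos hr ((h j hj).trans hi)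

theorem p_eval_neg {i : ℕ} (hi : Even i) (t : ℝ) : (p G i).eval (-t) = (p G i).eval t := by
  rw [p_eq, if_pos hi]
  simp

end Polynomials

/-! ### The structure scalars in closed form and the recursion of the g_i. -/

section Scalars

variable {X : Type*} [Fintype X] {G : SimpleGraph X}

/-- The scalar by which `E*_{i+2} A_{i+4} v` is a multiple of `E*_{i+2} A_i v`. -/
noncomputable def upperScalar (G : SimpleGraph X) (i : ℕ) : ℝ :=
  ((P G i).eval 0 / (P G (i + 2)).eval 0) *
    (((b G (i + 2) : ℝ) * b G (i + 3)) / ((c G (i + 1) : ℝ) * c G (i + 2)))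

/-- The scalar by which `E*_{i+2} A E*_{i+3} A_{i+1} v` is a multiple of `E*_{i+2} A_i v`. -/
noncomputable def lowerScalar (G : SimpleGraph X) : ℕ → ℝ
  | 0 => b G 2 - c G 2 * upperScalar G 0
  | i + 1 => b G (i + 3) + c G (i + 1) * upperScalar G i - c G (i + 3) * upperScalar G (i + 1)

theorem c_ne_zero (hr : IsDistanceRegular G) {i : ℕ} (hi : i + 1 ≤ G.diam) :
    (c G (i + 1) : ℝ) ≠ 0 := by
  exact_mod_cast (c_pos hr hi).ne'

theorem b_ne_zero (hr : IsDistanceRegular G) {i : ℕ} (hi : i < G.diam) : (b G i : ℝ) ≠ 0 := by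
  exact_mod_cast (b_pos hr hi).ne'

/-- For even i the recurrence of P_i(0) has only two terms, so the ratio P_i(0)/P_{i+2}(0) is
-c_{i+2}/b_{i+2}. -/
theorem upperScalar_even (hr : IsDistanceRegular G) (hb : G.IsBipartite) {i : ℕ}
    (hi : i + 2 < G.diam) (h : Even i) :
    upperScalar G i = -(b G (i + 3) / c G (i + 1)) := by
  have h1 := P_eval_zero_even hr hb hi.le h
  have h2 := P_eval_zero_ne_zero hr hb hi
  have h3 := c_ne_zero hr (i := i) (by omega)
  have h4 := c_ne_zero hr (i := i + 1) (by omega)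
  rw [upperScalar]
  field_simp
  linear_combination b G (i + 3) * h1

/-- Together with `lowerScalar_even`, this turns a three-term definition into a product, from which
vanishing or nonvanishing can be read off. -/
theorem lowerScalar_odd (hr : IsDistanceRegular G) (hb : G.IsBipartite) {i : ℕ}
    (hi : i + 3 ≤ G.diam) (h : Odd i) :
    lowerScalar G i = -(((P G i).eval 0 / (P G (i + 2)).eval 0) *
      ((b G (i + 2) * b G (i + 3)) / c G (i + 1))) := by
  obtain ⟨j, rfl⟩ : ∃ j, i = j + 1 := ⟨i - 1, by have := h.pos; omega⟩
  have hj : Even j := by grind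
  have h3 := c_ne_zero hr (i := j) (by omega)
  have h4 := c_ne_zero hr (i := j + 1) (by omega)
  have h5 := c_ne_zero hr (i := j + 2) (by omega)
  rw [lowerScalar, upperScalar_even hr hb (by omega) hj, upperScalar]
  have h2 := P_eval_zero_ne_zero hr hb (i := j + 3) (by omega)
  simp only [show j + 1 + 2 = j + 3 by ring, show j + 1 + 3 = j + 4 by ring,
    show j + 1 + 1 = j + 2 by ring] at *
  field_simp
  ring

theorem lowerScalar_even (hr : IsDistanceRegular G) (hb : G.IsBipartite) {i : ℕ}
    (hi : i + 3 < G.diam) (h : Even i) :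
    lowerScalar G i = -(((P G (i + 3)).eval 0 / (P G (i + 1)).eval 0) *
      ((c G (i + 2) * c G (i + 3)) / c G (i + 1))) := by
  have h0 := c_ne_zero hr (i := i) (by omega)
  have h1 := c_ne_zero hr (i := i + 1) (by omega)
  have h2 := c_ne_zero hr (i := i + 2) (by omega)
  have h4 := P_eval_zero_ne_zero hr hb (i := i + 1) (by omega)
  have h6 := P_eval_zero_odd hr hb (i := i + 1) (by omega) h.add_one
  have h7 := P_eval_zero_even hr hb (i := i) (by omega) h
  cases i with
  | zero =>
    rw [lowerScalar, upperScalar_even hr hb (by omega) h]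
    simp only [zero_add] at *
    have h8 : (P G 1).eval 0 = 1 := P_one_eval_zero hr (by omega)
    have h9 : (c G 1 : ℝ) = 1 := by exact_mod_cast c_one hr (by omega)
    rw [P_zero_eval_zero] at h7
    simp only [h8, h9] at *
    simp only [show 1 + 2 = 3 by rfl, show 1 + 1 = 2 by rfl] at h6
    field_simp
    linear_combination c G 2 * h6 + h7
  | succ j =>
    have hj : Odd j := by grind
    rw [lowerScalar, upperScalar_even hr hb (by omega) h, upperScalar]
    have h8 := P_eval_zero_ne_zero hr hb (i := j + 2) (by omega)
    have h9 := c_ne_zero hr (i := j) (by omega)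
    have h10 := P_eval_zero_odd hr hb (i := j) (by omega) hj
    simp only [show j + 1 + 2 = j + 3 by ring, show j + 1 + 3 = j + 4 by ring,
      show j + 1 + 1 = j + 2 by ring] at *
    field_simp
    linear_combination c G (j + 3) * h6 + h7 + b G (j + 3) * h10

/-- This is the relation that `IsLocalVector.dualIdem_recurrence_capped` imposes on the unknown
multiples; it identifies each of them with `upperScalar`. -/
theorem upperScalar_mul_lowerScalar (hr : IsDistanceRegular G) (hb : G.IsBipartite)
    {i : ℕ} (hi : i + 3 < G.diam) :
    upperScalar G (i + 1) * lowerScalar G i = b G (i + 4) * upperScalar G i := by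
  have h0 := c_ne_zero hr (i := i) (by omega)
  have h1 := c_ne_zero hr (i := i + 1) (by omega)
  have h2 := c_ne_zero hr (i := i + 2) (by omega)
  rcases Nat.even_or_odd i with h | h
  · have h3 := P_eval_zero_ne_zero hr hb (i := i + 1) (by omega)
    have h4 := P_eval_zero_ne_zero hr hb (i := i + 3) (by omega)
    rw [lowerScalar_even hr hb hi h, upperScalar_even hr hb (by omega) h, upperScalar]
    simp only [show i + 1 + 2 = i + 3 by ring, show i + 1 + 3 = i + 4 by ring,
      show i + 1 + 1 = i + 2 by ring] at *
    field_simp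
  · have h3 := P_eval_zero_ne_zero hr hb (i := i + 2) (by omega)
    rw [lowerScalar_odd hr hb (by omega) h, upperScalar_even hr hb (by omega) h.add_one,
      upperScalar]
    simp only [show i + 1 + 2 = i + 3 by ring, show i + 1 + 3 = i + 4 by ring,
      show i + 1 + 1 = i + 2 by ring] at *
    field_simp

theorem lowerScalar_ne_zero (hr : IsDistanceRegular G) (hb : G.IsBipartite)
    {i : ℕ} (hi : i + 3 < G.diam) : lowerScalar G i ≠ 0 := by
  have h0 := c_ne_zero hr (i := i) (by omega)
  have h1 := c_ne_zero hr (i := i + 1) (by omega)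
  have h2 := c_ne_zero hr (i := i + 2) (by omega)
  rcases Nat.even_or_odd i with h | h
  · have h3 := P_eval_zero_ne_zero hr hb (i := i + 1) (by omega)
    have h4 := P_eval_zero_ne_zero hr hb (i := i + 3) (by omega)
    rw [lowerScalar_even hr hb hi h]
    exact neg_ne_zero.2 (mul_ne_zero (div_ne_zero h4 h3) (div_ne_zero (mul_ne_zero h1 h2) h0))
  · have h3 := P_eval_zero_ne_zero hr hb (i := i) (by omega)
    have h4 := P_eval_zero_ne_zero hr hb (i := i + 2) (by omega)
    rw [lowerScalar_odd hr hb (by omega) h]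
    exact neg_ne_zero.2 (mul_ne_zero (div_ne_zero h3 h4) (div_ne_zero (mul_ne_zero
      (b_ne_zero hr (by omega)) (b_ne_zero hr hi)) h0))

/-- D even makes i = D - 3 odd, and the odd closed form contains the factor b_{i+3} = b_D = 0. -/
theorem lowerScalar_eq_zero (hr : IsDistanceRegular G) (hb : G.IsBipartite)
    (heven : Even G.diam) {i : ℕ} (hi : i + 3 = G.diam) : lowerScalar G i = 0 := by
  rw [lowerScalar_odd hr hb hi.le (by grind), hi, b_eq_zero hr.connected le_rfl hr]
  simp

theorem g_zero (hr : IsDistanceRegular G) (hD : 2 ≤ G.diam) : g G 0 = 1 := by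
  have h := b_ne_zero hr (i := 0) (by omega)
  have h1 := b_ne_zero hr (i := 1) (by omega)
  simp [g, sameParity_zero, P_zero_eval_zero, kk_zero hr, p_zero, h, h1]

theorem valencyProduct_ne_zero (hr : IsDistanceRegular G) {i : ℕ} (hi : i + 1 < G.diam) :
    (kk G i : ℝ) * b G i * b G (i + 1) ≠ 0 :=
  mul_ne_zero (mul_ne_zero (by exact_mod_cast (kk_pos hr (by omega)).ne')
    (b_ne_zero hr (by omega))) (b_ne_zero hr hi)

theorem g_one (hr : IsDistanceRegular G) (hb : G.IsBipartite) (hD : 3 ≤ G.diam) :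
    g G 1 = Polynomial.X := by
  rw [g, sameParity_one, Finset.sum_singleton, div_self (P_eval_zero_ne_zero hr hb (by omega)),
    div_self (valencyProduct_ne_zero hr (by omega)), p_one hr (by omega)]
  simp

/-- Passing from i to i + 2 multiplies all the old coefficients of g_i by one common factor, which
is `upperScalar`, and adds the term p_{i+2} with coefficient 1. -/
theorem g_add_two (hr : IsDistanceRegular G) (hb : G.IsBipartite) {i : ℕ} (hi : i + 3 < G.diam) :
    g G (i + 2) = p G (i + 2) + Polynomial.C (upperScalar G i) * g G i := by
  rw [g, sameParity_add_two, Finset.sum_insert (notMem_sameParity i),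
    div_self (P_eval_zero_ne_zero hr hb (by omega)),
    div_self (valencyProduct_ne_zero hr (i := i + 2) hi), mul_one, Polynomial.C_1, one_mul, g,
    Finset.mul_sum]
  refine congrArg (p G (i + 2) + ·) ?_
  refine Finset.sum_congr rfl fun h hh => ?_
  have hle : h ≤ i := by simp [sameParity] at hh; omega
  rw [← mul_assoc, ← Polynomial.C_mul]
  refine congrArg (fun t => Polynomial.C t * p G h) ?_
  have h1 := P_eval_zero_ne_zero hr hb (i := i) (by omega)
  have h2 := P_eval_zero_ne_zero hr hb (i := i + 2) (by omega)
  have h3 := valencyProduct_ne_zero hr (i := h) (by omega)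
  have h4 := c_ne_zero hr (i := i) (by omega)
  have h5 := c_ne_zero hr (i := i + 1) (by omega)
  have h6 : (b G i : ℝ) * kk G i = c G (i + 1) * kk G (i + 1) := by exact_mod_cast b_mul_kk hr i
  have h7 : (b G (i + 1) : ℝ) * kk G (i + 1) = c G (i + 2) * kk G (i + 2) := by
    exact_mod_cast b_mul_kk hr (i + 1)
  -- Two edge counts express k_{i+2} as k_i b_i b_{i+1} / (c_{i+1} c_{i+2}).
  have h8 : (kk G (i + 2) : ℝ) * b G (i + 2) * b G (i + 3) = (kk G i * b G i * b G (i + 1)) *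
      ((b G (i + 2) * b G (i + 3)) / (c G (i + 1) * c G (i + 2))) := by
    rw [mul_div_assoc', eq_div_iff (mul_ne_zero h4 h5)]
    rw [show i + 1 + 1 = i + 2 from rfl] at h5
    linear_combination -(b G (i + 2) * b G (i + 3) : ℝ) * (c G (i + 1) * h7 + b G (i + 1) * h6)
  rw [upperScalar, h8]
  generalize (kk G h : ℝ) * b G h * b G (h + 1) = K at *
  generalize (b G (i + 2) * b G (i + 3) : ℝ) / (c G (i + 1) * c G (i + 2)) = L at *
  field_simp

end Scalars

/-! ### Eigenvalues of the adjacency matrix, their symmetry, and the spectral decomposition. -/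

section Spectrum

variable {X : Type*} [Fintype X] {G : SimpleGraph X}

theorem dotProduct_adjacency (w u : X → ℂ) :
    star (distMatrix G 1 *ᵥ w) ⬝ᵥ u = star w ⬝ᵥ (distMatrix G 1 *ᵥ u) := by
  rw [Matrix.star_mulVec, (distMatrix_isHermitian G 1).eq, ← Matrix.dotProduct_mulVec]

variable [DecidableEq X]

/-- The vector `q(A) u`. -/
noncomputable def act (G : SimpleGraph X) (q : ℝ[X]) (u : X → ℂ) : X → ℂ :=
  (Polynomial.aeval (distMatrix G 1) q) *ᵥ u

theorem act_add (q r : ℝ[X]) (u : X → ℂ) : act G (q + r) u = act G q u + act G r u := by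
  simp [act, Matrix.add_mulVec]

theorem act_sum {ι : Type*} (s : Finset ι) (q : ι → ℝ[X]) (u : X → ℂ) :
    act G (∑ i ∈ s, q i) u = ∑ i ∈ s, act G (q i) u := by
  simp [act, Matrix.sum_mulVec]

theorem act_sub (q r : ℝ[X]) (u : X → ℂ) : act G (q - r) u = act G q u - act G r u := by
  simp [act, Matrix.sub_mulVec]

theorem act_C_mul (a : ℝ) (q : ℝ[X]) (u : X → ℂ) :
    act G (Polynomial.C a * q) u = (a : ℂ) • act G q u := by
  rw [← Polynomial.smul_eq_C_mul]
  simp only [act, map_smul]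
  rw [← Complex.coe_smul, Matrix.smul_mulVec]

theorem act_X_mul (q : ℝ[X]) (u : X → ℂ) :
    act G (Polynomial.X * q) u = distMatrix G 1 *ᵥ act G q u := by
  simp [act]

theorem act_one (u : X → ℂ) : act G 1 u = u := by simp [act]

theorem act_X (u : X → ℂ) : act G Polynomial.X u = distMatrix G 1 *ᵥ u := by simp [act]

theorem act_vec_sum {ι : Type*} (s : Finset ι) (q : ℝ[X]) (u : ι → X → ℂ) :
    act G q (∑ i ∈ s, u i) = ∑ i ∈ s, act G q (u i) := by
  simp only [act, Matrix.mulVec_sum]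

theorem act_f (hr : IsDistanceRegular G) (hb : G.IsBipartite) {i : ℕ} (hi : i ≤ G.diam)
    (u : X → ℂ) : act G (f G i) u = distMatrix G i *ᵥ u := by
  induction i using Nat.twoStepInduction with
  | zero => simp [f, act_one, distMatrix_zero hr.connected]
  | one => rw [f_one hr hi, act_X]
  | more i ih1 ih2 =>
    have h := congrArg (fun q => act G q u) (c_mul_f hr hi)
    have h4 := c_ne_zero hr (i := i + 1) hi
    simp only [act_C_mul, act_sub, act_X_mul, ih1 (by omega), ih2 (by omega),
      Matrix.mulVec_mulVec, distMatrix_one_mul hr hb, Matrix.add_mulVec, Matrix.smul_mulVec,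
      Complex.ofReal_natCast, add_sub_cancel_left] at h
    exact smul_right_injective _ (by exact_mod_cast h4 : (c G (i + 2) : ℂ) ≠ 0) h

theorem act_eigenvector {e : X → ℂ} {t : ℝ} (he : distMatrix G 1 *ᵥ e = (t : ℂ) • e) (q : ℝ[X]) :
    act G q e = ((q.eval t : ℝ) : ℂ) • e := by
  induction q using Polynomial.induction_on' with
  | add q r hq hr => simp [act_add, hq, hr, add_smul]
  | monomial n a =>
    rw [← Polynomial.C_mul_X_pow_eq_monomial, act_C_mul]
    have : act G (Polynomial.X ^ n) e = ((t ^ n : ℝ) : ℂ) • e := by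
      induction n with
      | zero => simp [act_one]
      | succ n ih =>
        rw [pow_succ', act_X_mul, ih, Matrix.mulVec_smul, he, smul_smul]
        push_cast
        ring_nf
    rw [this, smul_smul]
    simp

theorem primIdem_mulVec (i : ℕ) (u : X → ℂ) :
    primIdem G i *ᵥ u = WithLp.ofLp ((Module.End.eigenspace
      (Matrix.toEuclideanLin (distMatrix G 1)) ((theta G i : ℝ) : ℂ)).starProjection
        (WithLp.toLp 2 u)) := by
  rw [primIdem, ← Matrix.ofLp_toEuclideanCLM (𝕜 := ℂ) _ (WithLp.toLp 2 u)]
  simp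

theorem mem_eigenspace_toEuclideanLin (t : ℂ) (e : EuclideanSpace ℂ X) :
    e ∈ Module.End.eigenspace (Matrix.toEuclideanLin (distMatrix G 1)) t ↔
      distMatrix G 1 *ᵥ WithLp.ofLp e = t • WithLp.ofLp e := by
  rw [Module.End.mem_eigenspace_iff, ← (WithLp.ofLp_injective 2).eq_iff]
  simp

theorem adjacency_mulVec_primIdem (i : ℕ) (u : X → ℂ) :
    distMatrix G 1 *ᵥ (primIdem G i *ᵥ u) = (theta G i : ℂ) • (primIdem G i *ᵥ u) := by
  rw [primIdem_mulVec, ← mem_eigenspace_toEuclideanLin]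
  exact Submodule.starProjection_apply_mem _ _

theorem primIdem_mulVec_eq_zero {i : ℕ} {u : X → ℂ}
    (h : ∀ e : X → ℂ, distMatrix G 1 *ᵥ e = (theta G i : ℂ) • e → star e ⬝ᵥ u = 0) :
    primIdem G i *ᵥ u = 0 := by
  rw [primIdem_mulVec, (Submodule.starProjection_apply_eq_zero_iff _).2, WithLp.ofLp_zero]
  rw [Submodule.mem_orthogonal]
  intro e he
  rw [mem_eigenspace_toEuclideanLin] at he
  rw [EuclideanSpace.inner_eq_star_dotProduct, dotProduct_comm]
  exact h _ he

/-- `E_i A w = 0` when `θ_i = 0`. -/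
theorem primIdem_mulVec_adjacency_eq_zero {i : ℕ} (hi : theta G i = 0) (w : X → ℂ) :
    primIdem G i *ᵥ (distMatrix G 1 *ᵥ w) = 0 := by
  refine primIdem_mulVec_eq_zero fun e he => ?_
  rw [← dotProduct_adjacency, he, hi]
  simp

theorem dotProduct_act (q : ℝ[X]) (w u : X → ℂ) :
    star (act G q w) ⬝ᵥ u = star w ⬝ᵥ act G q u := by
  induction q using Polynomial.induction_on' with
  | add q r hq hr => simp [act_add, hq, hr, dotProduct_add, add_dotProduct]
  | monomial n a =>
    rw [← Polynomial.C_mul_X_pow_eq_monomial, act_C_mul, act_C_mul]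
    have : star (act G (Polynomial.X ^ n) w) ⬝ᵥ u = star w ⬝ᵥ act G (Polynomial.X ^ n) u := by
      induction n generalizing u with
      | zero => simp [act_one]
      | succ n ih =>
        rw [pow_succ', act_X_mul, dotProduct_adjacency, ih]
        congr 1
        rw [← pow_succ', pow_succ]
        simp [act, Matrix.mulVec_mulVec]
    simp [this]

/-- By self-adjointness, q(θ_i)⟨e, u⟩ = ⟨e, q(A)u⟩ = 0 for each eigenvector e of θ_i. -/
theorem primIdem_mulVec_eq_zero_of_act {i : ℕ} {q : ℝ[X]} {u : X → ℂ} (h : act G q u = 0)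
    (hq : q.eval (theta G i) ≠ 0) : primIdem G i *ᵥ u = 0 := by
  refine primIdem_mulVec_eq_zero fun e he => ?_
  have h1 := dotProduct_act (G := G) q e u
  rw [h, act_eigenvector he] at h1
  simpa [hq] using h1

/-- The set of eigenvalues of the adjacency matrix. -/
noncomputable def eigenvalueSet (G : SimpleGraph X) : Finset ℝ :=
  Finset.univ.image (distMatrix_isHermitian G 1).eigenvalues

theorem mem_spectrum_iff (t : ℂ) :
    t ∈ spectrum ℂ (distMatrix G 1) ↔ ∃ e : X → ℂ, e ≠ 0 ∧ distMatrix G 1 *ᵥ e = t • e := by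
  rw [← Matrix.spectrum_toLpLin 2, ← Module.End.hasEigenvalue_iff_mem_spectrum]
  constructor
  · intro h
    obtain ⟨e, he, he0⟩ := h.exists_hasEigenvector
    exact ⟨WithLp.ofLp e, by simpa using he0, (mem_eigenspace_toEuclideanLin t e).1 he⟩
  · rintro ⟨e, he0, he⟩
    refine Module.End.hasEigenvalue_of_hasEigenvector (x := WithLp.toLp 2 e) ⟨?_, by simpa using he0⟩
    exact (mem_eigenspace_toEuclideanLin t _).2 he

theorem mem_spectrum_iff_eigenvalueSet (t : ℂ) :
    t ∈ spectrum ℂ (distMatrix G 1) ↔ ∃ s ∈ eigenvalueSet G, (s : ℂ) = t := by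
  rw [(distMatrix_isHermitian G 1).spectrum_eq_image_range]
  simp [eigenvalueSet]

theorem mem_eigenvalueSet (t : ℝ) :
    t ∈ eigenvalueSet G ↔ ∃ e : X → ℂ, e ≠ 0 ∧ distMatrix G 1 *ᵥ e = (t : ℂ) • e := by
  rw [← mem_spectrum_iff, mem_spectrum_iff_eigenvalueSet]
  simp

theorem valency_mem (hr : IsDistanceRegular G) : (b G 0 : ℝ) ∈ eigenvalueSet G := by
  have := hr.connected.nonempty
  refine (mem_eigenvalueSet _).2 ⟨1, one_ne_zero, ?_⟩
  ext y
  simp [Matrix.mulVec, dotProduct, distMatrix, card_neighbors hr]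

theorem abs_le_of_mem_eigenvalueSet (hr : IsDistanceRegular G) {t : ℝ}
    (ht : t ∈ eigenvalueSet G) : |t| ≤ b G 0 := by
  obtain ⟨e, he0, he⟩ := (mem_eigenvalueSet t).1 ht
  have h : Module.End.HasEigenvalue (Matrix.toLin' (distMatrix G 1)) (t : ℂ) :=
    Module.End.hasEigenvalue_of_hasEigenvector (x := e)
      ⟨Module.End.mem_eigenspace_iff.2 (by simpa using he), he0⟩
  -- Gershgorin: A has zero diagonal, so the disc is centred at 0, with radius at most the row sum
  -- k.
  obtain ⟨k, hk⟩ := eigenvalue_mem_ball h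
  have h1 : distMatrix G 1 k k = 0 := by simp [distMatrix]
  rw [h1, mem_closedBall_zero_iff, Complex.norm_real, Real.norm_eq_abs] at hk
  refine hk.trans ((Finset.sum_le_sum_of_subset_of_nonneg (Finset.erase_subset k _)
    fun _ _ _ => norm_nonneg _).trans ?_)
  rw [← card_neighbors hr k, ← Finset.sum_boole]
  refine Finset.sum_le_sum fun j _ => ?_
  simp only [distMatrix, Matrix.of_apply]
  split_ifs <;> simp

/-- Changing the sign of an eigenvector on one colour class negates its eigenvalue. -/
theorem neg_mem_eigenvalueSet (hr : IsDistanceRegular G) (hb : G.IsBipartite) {t : ℝ}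
    (ht : t ∈ eigenvalueSet G) : -t ∈ eigenvalueSet G := by
  obtain ⟨e, he0, he⟩ := (mem_eigenvalueSet t).1 ht
  obtain ⟨col, hcol⟩ := exists_coloring hr.connected hb
  refine (mem_eigenvalueSet _).2 ⟨fun y => (if col y then 1 else -1) * e y, ?_, ?_⟩
  · intro h
    apply he0
    ext y
    have := congrFun h y
    simp only [Pi.zero_apply] at this ⊢
    split_ifs at this <;> simpa using this
  · ext y
    have h1 := congrFun he y
    simp only [Matrix.mulVec, dotProduct, Pi.smul_apply, smul_eq_mul] at h1 ⊢
    have h2 : ∀ z, distMatrix G 1 y z * ((if col z then 1 else -1) * e z) =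
        -(if col y then 1 else -1) * (distMatrix G 1 y z * e z) := by
      intro z
      by_cases h : G.dist y z = 1
      · have := hcol y z
        rw [h] at this
        simp only [Nat.not_even_one, false_iff] at this
        cases h3 : col y <;> cases h4 : col z <;> simp_all
      · simp [distMatrix, h]
    rw [Finset.sum_congr rfl fun z _ => h2 z, ← Finset.mul_sum, h1]
    push_cast
    ring

theorem eigenvalueSet_card_le (hr : IsDistanceRegular G) (hb : G.IsBipartite)
    (hD : 1 ≤ G.diam) : (eigenvalueSet G).card ≤ G.diam + 1 := by
  obtain ⟨n, hn⟩ : ∃ n, G.diam = n + 1 := ⟨G.diam - 1, by omega⟩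
  have hfd : ∀ i, i ≤ G.diam → (f G i).natDegree = i ∧ f G i ≠ 0 := by
    intro i
    induction i using Nat.twoStepInduction with
    | zero => simp [f]
    | one => intro h; simp [f_one hr h]
    | more i ih1 ih2 =>
      intro h
      obtain ⟨h1, h1'⟩ := ih1 (by omega)
      obtain ⟨h2, h2'⟩ := ih2 (by omega)
      have h3 := c_mul_f hr h
      have h4 := c_ne_zero hr (i := i + 1) h
      have h5 : (Polynomial.X * f G (i + 1) - Polynomial.C (b G i : ℝ) * f G i).natDegree =
          i + 2 := by
        rw [Polynomial.natDegree_sub_eq_left_of_natDegree_lt, Polynomial.natDegree_X_mul h2', h2]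
        rw [Polynomial.natDegree_X_mul h2', h2]
        exact (Polynomial.natDegree_C_mul_le _ _).trans_lt (by omega)
      rw [← h3, Polynomial.natDegree_C_mul h4] at h5
      exact ⟨h5, fun h0 => by simp [h0] at h5⟩
  obtain ⟨h1, h1'⟩ := hfd n (by omega)
  obtain ⟨h2, h2'⟩ := hfd (n + 1) (by omega)
  -- This polynomial, λ f_D - b_{D-1} f_{D-1}, has degree D + 1 and annihilates A because A_{D+1} =
  -- 0; all eigenvalues are among its roots.
  have hdeg : (Polynomial.X * f G (n + 1) - Polynomial.C (b G n : ℝ) * f G n).natDegree =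
      n + 2 := by
    rw [Polynomial.natDegree_sub_eq_left_of_natDegree_lt, Polynomial.natDegree_X_mul h2', h2]
    rw [Polynomial.natDegree_X_mul h2', h2]
    exact (Polynomial.natDegree_C_mul_le _ _).trans_lt (by omega)
  set q := Polynomial.X * f G (n + 1) - Polynomial.C (b G n : ℝ) * f G n with hq
  have hq0 : q ≠ 0 := fun h => by simp [h] at hdeg
  have hact : ∀ u, act G q u = 0 := by
    intro u
    rw [hq, act_sub, act_X_mul, act_C_mul, act_f hr hb (by omega), act_f hr hb (by omega),
      Matrix.mulVec_mulVec, distMatrix_one_mul hr hb,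
      distMatrix_eq_zero hr.connected (i := n + 2) (by omega), smul_zero, add_zero,
      Matrix.smul_mulVec]
    simp
  rw [hn, ← hdeg]
  refine (Finset.card_le_card fun t ht => ?_).trans
    ((Multiset.toFinset_card_le q.roots).trans (Polynomial.card_roots' q))
  obtain ⟨e, he0, he⟩ := (mem_eigenvalueSet t).1 ht
  rw [Multiset.mem_toFinset, Polynomial.mem_roots hq0, Polynomial.IsRoot]
  have := hact e
  rw [act_eigenvector he, smul_eq_zero] at this
  simpa [he0] using this

theorem iSup_eigenspaces (G : SimpleGraph X) :
    ⨆ t : eigenvalueSet G, Module.End.eigenspace (Matrix.toEuclideanLin (distMatrix G 1))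
      ((t : ℝ) : ℂ) = ⊤ := by
  have hs : (Matrix.toEuclideanLin (distMatrix G 1)).IsSymmetric :=
    Matrix.isSymmetric_toEuclideanLin_iff.2 (distMatrix_isHermitian G 1)
  have h := Submodule.orthogonal_eq_bot_iff.1 hs.orthogonalComplement_iSup_eigenspaces_eq_bot
  rw [eq_top_iff, ← h]
  refine iSup_le fun t => ?_
  by_cases ht : t ∈ spectrum ℂ (distMatrix G 1)
  · obtain ⟨s, hs, rfl⟩ := (mem_spectrum_iff_eigenvalueSet t).1 ht
    exact le_iSup (fun t : eigenvalueSet G => Module.End.eigenspace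
      (Matrix.toEuclideanLin (distMatrix G 1)) ((t : ℝ) : ℂ)) ⟨s, hs⟩
  · rw [← Matrix.spectrum_toLpLin 2, ← Module.End.hasEigenvalue_iff_mem_spectrum,
      Module.End.hasEigenvalue_iff, not_not] at ht
    rw [ht]
    exact bot_le

/-- Vectors are determined by their inner products with eigenvectors. -/
theorem eq_zero_of_eigenvectors {w : X → ℂ}
    (h : ∀ t ∈ eigenvalueSet G, ∀ e : X → ℂ, distMatrix G 1 *ᵥ e = (t : ℂ) • e →
      star e ⬝ᵥ w = 0) : w = 0 := by
  have h1 : WithLp.toLp 2 w ∈ (⨆ t : eigenvalueSet G, Module.End.eigenspace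
      (Matrix.toEuclideanLin (distMatrix G 1)) ((t : ℝ) : ℂ))ᗮ := by
    rw [← Submodule.iInf_orthogonal, Submodule.mem_iInf]
    intro t
    rw [Submodule.mem_orthogonal]
    intro e he
    rw [mem_eigenspace_toEuclideanLin] at he
    rw [EuclideanSpace.inner_eq_star_dotProduct, dotProduct_comm]
    exact h t t.2 _ he
  rw [iSup_eigenspaces, Submodule.top_orthogonal_eq_bot, Submodule.mem_bot] at h1
  simpa using h1

theorem act_prod_eigenvalues (u : X → ℂ) :
    act G (∏ t ∈ eigenvalueSet G, (Polynomial.X - Polynomial.C t)) u = 0 := by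
  refine eq_zero_of_eigenvectors (G := G) fun t ht e he => ?_
  rw [← dotProduct_act, act_eigenvector he, Polynomial.eval_prod, Finset.prod_eq_zero ht] <;> simp

theorem pow_apply_of_lt_dist (hG : G.Connected) {n : ℕ} {y z : X} (h : n < G.dist y z) :
    (distMatrix G 1 ^ n) y z = 0 := by
  induction n generalizing y with
  | zero =>
    rw [pow_zero, Matrix.one_apply_ne]
    rintro rfl
    simp at h
  | succ n ih =>
    rw [pow_succ', Matrix.mul_apply]
    refine Finset.sum_eq_zero fun w _ => ?_
    by_cases hw : G.dist y w = 1
    · have := hG.dist_triangle (u := y) (v := w) (w := z)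
      rw [ih (by omega), mul_zero]
    · simp [distMatrix, hw]

theorem pow_apply_dist (hG : G.Connected) {n : ℕ} {y z : X} (h : G.dist y z = n) :
    ∃ m : ℕ, 0 < m ∧ (distMatrix G 1 ^ n) y z = m := by
  induction n generalizing y with
  | zero =>
    rw [hG.dist_eq_zero_iff] at h
    exact ⟨1, by simp [h]⟩
  | succ n ih =>
    choose m hm hm' using fun w : {w // G.dist w z = n} => ih w.2
    obtain ⟨w, hw, hw'⟩ := exists_neighbor_dist hG h
    refine ⟨∑ w, if h : G.dist y w = 1 ∧ G.dist w z = n then m ⟨w, h.2⟩ else 0, ?_, ?_⟩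
    · refine Finset.sum_pos' (fun _ _ => Nat.zero_le _) ⟨w, Finset.mem_univ _, ?_⟩
      rw [dif_pos ⟨hw, hw'⟩]
      exact hm _
    · rw [pow_succ', Matrix.mul_apply]
      push_cast
      refine Finset.sum_congr rfl fun w _ => ?_
      by_cases hw : G.dist y w = 1
      · by_cases hw' : G.dist w z = n
        · rw [hm' ⟨w, hw'⟩, dif_pos ⟨hw, hw'⟩]
          simp [distMatrix, hw]
        · have := hG.dist_triangle (u := y) (v := w) (w := z)
          rw [pow_apply_of_lt_dist hG (by omega), dif_neg (by tauto)]
          simp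
      · simp [distMatrix, hw]

/-- The product of the X - t over the eigenvalues annihilates A. If its degree n were at most D, its
entry at a pair at distance n would be that of A^n alone, which is positive. -/
theorem lt_eigenvalueSet_card (hG : G.Connected) : G.diam < (eigenvalueSet G).card := by
  by_contra! hlt
  set q := ∏ t ∈ eigenvalueSet G, (Polynomial.X - Polynomial.C t) with hq
  have hdeg : q.natDegree = (eigenvalueSet G).card := by
    rw [hq, Polynomial.natDegree_prod_of_monic _ _ fun t _ => Polynomial.monic_X_sub_C t]
    simp
  have hmon : q.Monic := Polynomial.monic_prod_of_monic _ _ fun t _ => Polynomial.monic_X_sub_C t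
  obtain ⟨y, z, hyz⟩ := exists_dist_eq hG hlt
  obtain ⟨m, hm, hm'⟩ := pow_apply_dist hG hyz
  have h0 : Polynomial.aeval (distMatrix G 1) q = 0 := by
    exact Matrix.ext_of_mulVec_single fun i =>
      (act_prod_eigenvalues _).trans (Matrix.zero_mulVec _).symm
  have h1 := congrFun (congrFun h0 y) z
  rw [Polynomial.aeval_eq_sum_range, hdeg, Matrix.sum_apply, Finset.sum_range_succ,
    Finset.sum_eq_zero, ← hdeg, hmon.coeff_natDegree, hdeg] at h1
  · simp [hm', hm.ne'] at h1
  · intro i hi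
    rw [Matrix.smul_apply, pow_apply_of_lt_dist hG, smul_zero]
    rw [hyz]
    simpa using hi

theorem eigenvalueSet_card (hr : IsDistanceRegular G) (hb : G.IsBipartite) (hD : 1 ≤ G.diam) :
    (eigenvalueSet G).card = G.diam + 1 :=
  le_antisymm (eigenvalueSet_card_le hr hb hD) (lt_eigenvalueSet_card hr.connected)

theorem eigenvalueList_length (hr : IsDistanceRegular G) (hb : G.IsBipartite)
    (hD : 1 ≤ G.diam) : (eigenvalueList G).length = G.diam + 1 := by
  rw [eigenvalueList, Finset.length_sort]
  exact eigenvalueSet_card hr hb hD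

theorem mem_eigenvalueList (t : ℝ) : t ∈ eigenvalueList G ↔ t ∈ eigenvalueSet G := by
  rw [eigenvalueList, Finset.mem_sort, eigenvalueSet]

/-- Both lists are decreasing enumerations of one symmetric set, hence equal. -/
theorem eigenvalueList_reverse_neg (hr : IsDistanceRegular G) (hb : G.IsBipartite) :
    (eigenvalueList G).reverse.map (fun t => -t) = eigenvalueList G := by
  have hs : (eigenvalueList G).Pairwise (· ≥ ·) := Finset.pairwise_sort _ _
  have hn : (eigenvalueList G).Nodup := Finset.sort_nodup _ _
  refine List.Perm.eq_of_pairwise' (r := (· ≥ ·)) ?_ hs ?_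
  · rw [List.pairwise_map, List.pairwise_reverse]
    exact hs.imp fun h => neg_le_neg h
  · rw [List.perm_ext_iff_of_nodup _ hn]
    · intro t
      simp only [List.mem_map, List.mem_reverse, mem_eigenvalueList]
      constructor
      · rintro ⟨s, hs, rfl⟩
        exact neg_mem_eigenvalueSet hr hb hs
      · exact fun h => ⟨-t, neg_mem_eigenvalueSet hr hb h, neg_neg t⟩
    · exact (List.nodup_reverse.2 hn).map neg_injective

theorem theta_eq_getElem (hr : IsDistanceRegular G) (hb : G.IsBipartite) (hD : 1 ≤ G.diam)
    {i : ℕ} (hi : i ≤ G.diam) : theta G i = (eigenvalueList G)[i]'(by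
      rw [eigenvalueList_length hr hb hD]; omega) := by
  rw [theta, List.getD_eq_getElem]

theorem theta_symm (hr : IsDistanceRegular G) (hb : G.IsBipartite) (hD : 1 ≤ G.diam)
    {i : ℕ} (hi : i ≤ G.diam) : theta G (G.diam - i) = -theta G i := by
  have hl := eigenvalueList_length hr hb hD
  rw [theta_eq_getElem hr hb hD (Nat.sub_le _ _), theta_eq_getElem hr hb hD hi]
  have h := eigenvalueList_reverse_neg hr hb
  have h1 : (eigenvalueList G)[G.diam - i]'(by omega) =
      ((eigenvalueList G).reverse.map (fun t => -t))[G.diam - i]'(by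
        rw [h]; omega) := by simp only [h]
  rw [h1]
  simp only [List.getElem_map, List.getElem_reverse, hl]
  congr 2
  omega

theorem theta_half (hr : IsDistanceRegular G) (hb : G.IsBipartite) (hD : 1 ≤ G.diam)
    {d : ℕ} (hd : G.diam = 2 * d) : theta G d = 0 := by
  have h := theta_symm hr hb hD (i := d) (by omega)
  rw [show G.diam - d = d by omega] at h
  linarith

theorem theta_injOn (hr : IsDistanceRegular G) (hb : G.IsBipartite) (hD : 1 ≤ G.diam) :
    Set.InjOn (theta G) (Set.Iic G.diam) := by
  intro i hi j hj h
  rw [theta_eq_getElem hr hb hD hi, theta_eq_getElem hr hb hD hj] at h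
  exact (List.Nodup.getElem_inj_iff (Finset.sort_nodup _ _)).1 h

theorem exists_theta_eq (hr : IsDistanceRegular G) (hb : G.IsBipartite) (hD : 1 ≤ G.diam)
    {t : ℝ} (ht : t ∈ eigenvalueSet G) : ∃ i ≤ G.diam, theta G i = t := by
  obtain ⟨i, hi, h⟩ := List.getElem_of_mem ((mem_eigenvalueList t).2 ht)
  have hl := eigenvalueList_length hr hb hD
  exact ⟨i, by omega, by rw [theta_eq_getElem hr hb hD (by omega), h]⟩

theorem theta_mem (hr : IsDistanceRegular G) (hb : G.IsBipartite) (hD : 1 ≤ G.diam)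
    {i : ℕ} (hi : i ≤ G.diam) : theta G i ∈ eigenvalueSet G := by
  rw [← mem_eigenvalueList, theta_eq_getElem hr hb hD hi]
  exact List.getElem_mem _

theorem theta_zero (hr : IsDistanceRegular G) (hb : G.IsBipartite) (hD : 1 ≤ G.diam) :
    theta G 0 = b G 0 := by
  refine le_antisymm ((le_abs_self _).trans
    (abs_le_of_mem_eigenvalueSet hr (theta_mem hr hb hD (Nat.zero_le _)))) ?_
  obtain ⟨i, hi, h⟩ := exists_theta_eq hr hb hD (valency_mem hr)
  rw [← h, theta_eq_getElem hr hb hD hi, theta_eq_getElem hr hb hD (Nat.zero_le _)]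
  have hs : (eigenvalueList G).Pairwise (· ≥ ·) := Finset.pairwise_sort _ _
  rcases Nat.eq_zero_or_pos i with rfl | h0
  · exact le_rfl
  · exact List.pairwise_iff_getElem.1 hs 0 i _ _ h0

theorem theta_diam (hr : IsDistanceRegular G) (hb : G.IsBipartite) (hD : 1 ≤ G.diam) :
    theta G G.diam = -b G 0 := by
  have := theta_symm hr hb hD (Nat.zero_le _)
  rwa [theta_zero hr hb hD] at this

theorem sum_primIdem (hr : IsDistanceRegular G) (hb : G.IsBipartite) (hD : 1 ≤ G.diam)
    (u : X → ℂ) : ∑ j ∈ Finset.range (G.diam + 1), primIdem G j *ᵥ u = u := by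
  have hs : (Matrix.toEuclideanLin (distMatrix G 1)).IsSymmetric :=
    Matrix.isSymmetric_toEuclideanLin_iff.2 (distMatrix_isHermitian G 1)
  have hinj : Function.Injective fun j : Fin (G.diam + 1) => ((theta G j : ℝ) : ℂ) := by
    intro i j h
    have h1 : theta G i = theta G j := by simpa using h
    exact Fin.ext (theta_injOn hr hb hD (Nat.le_of_lt_succ i.2) (Nat.le_of_lt_succ j.2) h1)
  have hO := hs.orthogonalFamily_eigenspaces.comp hinj
  have hmem : WithLp.toLp 2 u ∈ ⨆ j : Fin (G.diam + 1), Module.End.eigenspace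
      (Matrix.toEuclideanLin (distMatrix G 1)) ((theta G j : ℝ) : ℂ) := by
    have h : (⊤ : Submodule ℂ (EuclideanSpace ℂ X)) ≤ ⨆ j : Fin (G.diam + 1),
        Module.End.eigenspace (Matrix.toEuclideanLin (distMatrix G 1))
          ((theta G j : ℝ) : ℂ) := by
      rw [← iSup_eigenspaces G]
      refine iSup_le fun t => ?_
      obtain ⟨i, hi, h⟩ := exists_theta_eq hr hb hD t.2
      rw [← h]
      exact le_iSup (fun j : Fin (G.diam + 1) => Module.End.eigenspace
        (Matrix.toEuclideanLin (distMatrix G 1)) ((theta G j : ℝ) : ℂ)) ⟨i, by omega⟩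
    exact h Submodule.mem_top
  have h := congrArg WithLp.ofLp (hO.sum_projection_of_mem_iSup _ hmem)
  rw [Finset.sum_range]
  simp only [primIdem_mulVec]
  rw [← WithLp.ofLp_sum]
  exact h

end Spectrum

/-! ### Vectors supported on spheres and the action of A on them. -/

section LocalVectors

variable {X : Type*} [Fintype X] {G : SimpleGraph X} {x : X}

theorem distMatrix_mulVec_apply (n : ℕ) (u : X → ℂ) (y : X) :
    (distMatrix G n *ᵥ u) y = ∑ z, if G.dist y z = n then u z else 0 := by
  simp [distMatrix, Matrix.mulVec, dotProduct]

variable [DecidableEq X]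

theorem dualIdem_mulVec_apply (n : ℕ) (u : X → ℂ) (y : X) :
    (dualIdem G x n *ᵥ u) y = if G.dist x y = n then u y else 0 := by
  simp [dualIdem, Matrix.mulVec_diagonal]

theorem dualIdem_mulVec_self (n : ℕ) (u : X → ℂ) :
    dualIdem G x n *ᵥ (dualIdem G x n *ᵥ u) = dualIdem G x n *ᵥ u := by
  ext y
  simp only [dualIdem_mulVec_apply]
  split_ifs <;> rfl

theorem dualIdem_mulVec_of_ne {m n : ℕ} (h : m ≠ n) {u : X → ℂ} (hu : dualIdem G x n *ᵥ u = u) :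
    dualIdem G x m *ᵥ u = 0 := by
  rw [← hu]
  ext y
  simp only [dualIdem_mulVec_apply, Pi.zero_apply]
  split_ifs <;> first | rfl | omega

theorem apply_eq_zero_of_dualIdem {n : ℕ} {u : X → ℂ} (hu : dualIdem G x n *ᵥ u = u) {y : X}
    (hy : G.dist x y ≠ n) : u y = 0 := by
  rw [← hu, dualIdem_mulVec_apply, if_neg hy]

theorem adjacency_mulVec_apply_eq_zero (hG : G.Connected) (hb : G.IsBipartite) {n : ℕ}
    {u : X → ℂ} (hu : dualIdem G x n *ᵥ u = u) {y : X} (h1 : G.dist x y ≠ n + 1)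
    (h2 : n ≠ G.dist x y + 1) : (distMatrix G 1 *ᵥ u) y = 0 := by
  rw [distMatrix_mulVec_apply]
  refine Finset.sum_eq_zero fun z _ => ?_
  split_ifs with h
  · refine apply_eq_zero_of_dualIdem hu ?_
    rintro rfl
    have h3 := even_dist_add hG hb x y z
    have h4 := hG.dist_triangle (u := x) (v := y) (w := z)
    have h5 := hG.dist_triangle (u := x) (v := z) (w := y)
    rw [SimpleGraph.dist_comm (u := z)] at h5
    rw [h] at h3 h4 h5
    grind
  · rfl

theorem dualIdem_mulVec_adjacency_eq_zero (hG : G.Connected) (hb : G.IsBipartite) {m n : ℕ}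
    {u : X → ℂ} (hu : dualIdem G x n *ᵥ u = u) (h1 : m ≠ n + 1) (h2 : n ≠ m + 1) :
    dualIdem G x m *ᵥ (distMatrix G 1 *ᵥ u) = 0 := by
  ext y
  rw [dualIdem_mulVec_apply]
  split_ifs with h
  · subst h
    exact adjacency_mulVec_apply_eq_zero hG hb hu h1 h2
  · rfl

theorem adjacency_mulVec_eq_add (hG : G.Connected) (hb : G.IsBipartite) {n : ℕ}
    {u : X → ℂ} (hu : dualIdem G x (n + 1) *ᵥ u = u) :
    distMatrix G 1 *ᵥ u = dualIdem G x (n + 2) *ᵥ (distMatrix G 1 *ᵥ u) +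
      dualIdem G x n *ᵥ (distMatrix G 1 *ᵥ u) := by
  ext y
  rw [Pi.add_apply, dualIdem_mulVec_apply, dualIdem_mulVec_apply]
  by_cases h1 : G.dist x y = n + 2
  · simp [h1]
  · by_cases h2 : G.dist x y = n
    · simp [h2]
    · rw [adjacency_mulVec_apply_eq_zero hG hb hu (by omega) (by omega)]
      simp

/-- The vector `E*_{i+2} A_i v`. -/
noncomputable def raised (G : SimpleGraph X) (x : X) (v : X → ℂ) (i : ℕ) : X → ℂ :=
  dualIdem G x (i + 2) *ᵥ (distMatrix G i *ᵥ v)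

/-- The vector `E*_i A_{i+2} v`. -/
noncomputable def capped (G : SimpleGraph X) (x : X) (v : X → ℂ) (i : ℕ) : X → ℂ :=
  dualIdem G x i *ᵥ (distMatrix G (i + 2) *ᵥ v)

theorem dualIdem_raised (v : X → ℂ) (i : ℕ) :
    dualIdem G x (i + 2) *ᵥ raised G x v i = raised G x v i := dualIdem_mulVec_self _ _

theorem dualIdem_capped (v : X → ℂ) (i : ℕ) :
    dualIdem G x i *ᵥ capped G x v i = capped G x v i := dualIdem_mulVec_self _ _

theorem raised_zero (hG : G.Connected) {v : X → ℂ} (hv : dualIdem G x 2 *ᵥ v = v) :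
    raised G x v 0 = v := by
  rw [raised, distMatrix_zero hG, Matrix.one_mulVec, hv]

theorem mem_sameParity {h i : ℕ} : h ∈ sameParity i ↔ h ≤ i ∧ Even (i + h) := by
  simp only [sameParity, Finset.mem_filter, Finset.mem_range, Nat.lt_succ_iff]
  refine and_congr_right fun hle => ?_
  rw [Nat.even_sub hle, Nat.even_add]

theorem act_p_apply (hr : IsDistanceRegular G) (hb : G.IsBipartite) {i : ℕ} (hi : i ≤ G.diam)
    (v : X → ℂ) (y : X) :
    act G (p G i) v y = ∑ z, if G.dist y z ≤ i ∧ Even (i + G.dist y z) then v z else 0 := by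
  rw [p, act_sum, Finset.sum_congr rfl fun h hh => act_f hr hb ((mem_sameParity.1 hh).1.trans hi) v,
    Finset.sum_apply]
  simp only [distMatrix_mulVec_apply]
  rw [Finset.sum_comm]
  refine Finset.sum_congr rfl fun z _ => ?_
  rw [Finset.sum_ite_eq]
  simp only [mem_sameParity]

/-- At y the left side sums v over those z with ∂(y,z) ≤ i and of the parity of i. On the sphere of
radius i + 2 only ∂(y,z) = i survives; on radius i only ∂(y,z) = i + 2 is missed; at smaller radii
of the right parity every z in the support counts and the sum is 0; elsewhere there is none. -/
theorem act_p_eq (hr : IsDistanceRegular G) (hb : G.IsBipartite) {i : ℕ} (hi : i ≤ G.diam)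
    {v : X → ℂ} (hv : dualIdem G x 2 *ᵥ v = v) (hs : ∑ z, v z = 0) :
    act G (p G i) v = raised G x v i - capped G x v i := by
  ext y
  rw [act_p_apply hr hb hi, Pi.sub_apply, raised, capped, dualIdem_mulVec_apply,
    dualIdem_mulVec_apply, distMatrix_mulVec_apply, distMatrix_mulVec_apply]
  have hz : ∀ z, v z ≠ 0 → G.dist x z = 2 := fun z h => by
    by_contra h'
    exact h (apply_eq_zero_of_dualIdem hv h')
  have hdist : ∀ z, v z ≠ 0 → Even (G.dist x y + G.dist y z) ∧ 2 ≤ G.dist x y + G.dist y z ∧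
      G.dist x y ≤ G.dist y z + 2 ∧ G.dist y z ≤ G.dist x y + 2 := by
    intro z h
    have h0 := hz z h
    have h3 := even_dist_add hr.connected hb x y z
    have h4 := hr.connected.dist_triangle (u := x) (v := y) (w := z)
    have h5 := hr.connected.dist_triangle (u := x) (v := z) (w := y)
    have h6 := hr.connected.dist_triangle (u := y) (v := x) (w := z)
    rw [SimpleGraph.dist_comm (u := z)] at h5
    rw [SimpleGraph.dist_comm (u := y) (v := x)] at h6
    rw [h0] at h3 h4 h5 h6
    refine ⟨?_, h4, by omega, by omega⟩
    simpa [Nat.even_add] using h3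
  by_cases h1 : G.dist x y = i + 2
  · rw [if_pos h1, if_neg (by omega), sub_zero]
    refine Finset.sum_congr rfl fun z _ => ?_
    by_cases hvz : v z = 0
    · simp [hvz]
    · obtain ⟨h2, h3, h4, h5⟩ := hdist z hvz
      congr 1
      rw [eq_iff_iff]
      constructor
      · rintro ⟨h, -⟩; omega
      · intro h; rw [h]; exact ⟨le_rfl, by simp⟩
  · rw [if_neg h1, zero_sub]
    by_cases h2 : G.dist x y = i
    -- The two sums are complementary on the support of v, so together they give the total sum 0.
    · rw [if_pos h2, eq_neg_iff_add_eq_zero, ← Finset.sum_add_distrib]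
      refine Eq.trans ?_ hs
      refine Finset.sum_congr rfl fun z _ => ?_
      by_cases hvz : v z = 0
      · simp [hvz]
      · obtain ⟨h3, h4, h5, h6⟩ := hdist z hvz
        by_cases h7 : G.dist y z = i + 2
        · simp [h7]
        · have h8 : G.dist y z ≠ i + 1 := by
            intro h8
            rw [h8, h2] at h3
            grind
          rw [if_neg h7, if_pos ⟨by omega, by rwa [h2] at h3⟩, add_zero]
    · rw [if_neg h2, neg_zero]
      by_cases h3 : G.dist x y < i ∧ Even (i + G.dist x y)
      · obtain ⟨h3, h4⟩ := h3
        refine Eq.trans ?_ hs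
        refine Finset.sum_congr rfl fun z _ => ?_
        by_cases hvz : v z = 0
        · simp [hvz]
        · obtain ⟨h5, h6, h7, h8⟩ := hdist z hvz
          rw [if_pos]
          have h9 : G.dist x y ≠ i - 1 := by
            intro h9
            rw [h9] at h4
            grind
          exact ⟨by omega, by grind⟩
      · refine Finset.sum_eq_zero fun z _ => ?_
        by_cases hvz : v z = 0
        · simp [hvz]
        · obtain ⟨h5, h6, h7, h8⟩ := hdist z hvz
          rw [if_neg]
          rintro ⟨h9, h10⟩
          have h11 : Even (i + G.dist x y) := by grind
          have h12 : G.dist x y ≠ i + 1 := by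
            intro h12
            rw [h12] at h11
            grind
          exact h3 ⟨by omega, h11⟩

/-- The properties of a nonzero vector of `E*_2 W`, for a thin irreducible module `W` of endpoint
two and local eigenvalue `b_3 - 1`, from which the action of `A` on `W` is determined. -/
structure IsLocalVector (G : SimpleGraph X) (x : X) (v : X → ℂ) : Prop where
  ne_zero : v ≠ 0
  dual_two : dualIdem G x 2 *ᵥ v = v
  sum_eq_zero : ∑ z, v z = 0
  dual_one : dualIdem G x 1 *ᵥ (distMatrix G 1 *ᵥ v) = 0
  local_eigenvalue : dualIdem G x 2 *ᵥ (distMatrix G 2 *ᵥ v) = ((b G 3 : ℂ) - 1) • v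
  exists_upper : ∀ i, i + 2 ≤ G.diam → raised G x v i ≠ 0 →
    ∃ s : ℂ, capped G x v (i + 2) = s • raised G x v i
  exists_lower : ∀ i, i + 2 ≤ G.diam → raised G x v i ≠ 0 →
    ∃ s : ℂ, dualIdem G x (i + 2) *ᵥ (distMatrix G 1 *ᵥ raised G x v (i + 1)) =
      s • raised G x v i

/-! ### Determination of the scalars and the expansion of local vectors. -/

variable {v : X → ℂ}

theorem IsLocalVector.capped_one (hv : IsLocalVector G x v) (hr : IsDistanceRegular G)
    (hb : G.IsBipartite) (hD : 1 ≤ G.diam) : capped G x v 1 = 0 := by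
  have h := congrArg (dualIdem G x 1 *ᵥ ·) (act_p_eq hr hb hD hv.dual_two hv.sum_eq_zero)
  simp only [p_one hr hD, act_X, hv.dual_one, Matrix.mulVec_sub, dualIdem_capped,
    dualIdem_mulVec_of_ne (by omega : 1 ≠ 1 + 2) (dualIdem_raised v 1)] at h
  simpa using h

theorem IsLocalVector.recurrence (hv : IsLocalVector G x v) (hr : IsDistanceRegular G)
    (hb : G.IsBipartite) {i : ℕ} (hi : i + 2 ≤ G.diam) :
    distMatrix G 1 *ᵥ raised G x v (i + 1) - distMatrix G 1 *ᵥ capped G x v (i + 1) =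
      (c G (i + 2) : ℂ) • (raised G x v (i + 2) - capped G x v (i + 2)) +
      (b G (i + 2) : ℂ) • (raised G x v i - capped G x v i) := by
  have h := congrArg (fun q => act G q v) (X_mul_p hr hb hi)
  simp only [act_X_mul, act_add, act_C_mul] at h
  rw [act_p_eq hr hb hi hv.dual_two hv.sum_eq_zero,
    act_p_eq hr hb (by omega) hv.dual_two hv.sum_eq_zero,
    act_p_eq hr hb (by omega) hv.dual_two hv.sum_eq_zero, Matrix.mulVec_sub] at h
  simpa using h

theorem IsLocalVector.adjacency_raised_zero (hv : IsLocalVector G x v)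
    (hr : IsDistanceRegular G) (hb : G.IsBipartite) (hD : 1 ≤ G.diam) :
    distMatrix G 1 *ᵥ raised G x v 0 = raised G x v 1 := by
  have h := act_p_eq hr hb hD hv.dual_two hv.sum_eq_zero
  rw [hv.capped_one hr hb hD, p_one hr hD, act_X, sub_zero] at h
  rw [raised_zero hr.connected hv.dual_two, h]

/-- The outward part of A r_{i+1} is found by comparing components of `IsLocalVector.recurrence` on
the sphere of radius i + 4, where only the r_{i+2} term of the right side is left. -/
theorem IsLocalVector.adjacency_raised (hv : IsLocalVector G x v)
    (hr : IsDistanceRegular G) (hb : G.IsBipartite) {i : ℕ} (hi : i + 2 ≤ G.diam) :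
    distMatrix G 1 *ᵥ raised G x v (i + 1) = (c G (i + 2) : ℂ) • raised G x v (i + 2) +
      dualIdem G x (i + 2) *ᵥ (distMatrix G 1 *ᵥ raised G x v (i + 1)) := by
  have h1 := congrArg (dualIdem G x (i + 4) *ᵥ ·) (hv.recurrence hr hb hi)
  simp only [Matrix.mulVec_sub, Matrix.mulVec_add, Matrix.mulVec_smul] at h1
  rw [dualIdem_mulVec_adjacency_eq_zero hr.connected hb (dualIdem_capped v (i + 1)) (by omega)
    (by omega), dualIdem_mulVec_of_ne (by omega) (dualIdem_capped v (i + 2)),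
    dualIdem_mulVec_of_ne (by omega) (dualIdem_capped v i),
    dualIdem_mulVec_of_ne (by omega) (dualIdem_raised v i),
    dualIdem_raised v (i + 2)] at h1
  conv_lhs => rw [adjacency_mulVec_eq_add hr.connected hb (dualIdem_raised v (i + 1))]
  simp only [sub_zero, smul_zero, add_zero] at h1
  rw [← h1]

/-- The coefficient of `E*_{i+2}A E*_{i+3}A_{i+1}v`, given those of the vectors `E*_jA_{j+2}v`. -/
theorem IsLocalVector.dualIdem_recurrence (hv : IsLocalVector G x v)
    (hr : IsDistanceRegular G) (hb : G.IsBipartite) {i : ℕ} (hi : i + 2 ≤ G.diam) :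
    dualIdem G x (i + 2) *ᵥ (distMatrix G 1 *ᵥ raised G x v (i + 1)) -
      dualIdem G x (i + 2) *ᵥ (distMatrix G 1 *ᵥ capped G x v (i + 1)) =
      -((c G (i + 2) : ℂ) • capped G x v (i + 2)) + (b G (i + 2) : ℂ) • raised G x v i := by
  have h1 := congrArg (dualIdem G x (i + 2) *ᵥ ·) (hv.recurrence hr hb hi)
  simp only [Matrix.mulVec_sub, Matrix.mulVec_add, Matrix.mulVec_smul] at h1
  rw [dualIdem_mulVec_of_ne (by omega) (dualIdem_raised v (i + 2)), dualIdem_capped,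
    dualIdem_mulVec_of_ne (by omega) (dualIdem_capped v i), dualIdem_raised v i] at h1
  simpa using h1

theorem IsLocalVector.dualIdem_recurrence_capped (hv : IsLocalVector G x v)
    (hr : IsDistanceRegular G) (hb : G.IsBipartite) {i : ℕ} (hi : i + 3 ≤ G.diam) :
    dualIdem G x (i + 1) *ᵥ (distMatrix G 1 *ᵥ capped G x v (i + 2)) =
      (b G (i + 3) : ℂ) • capped G x v (i + 1) := by
  have h1 := congrArg (dualIdem G x (i + 1) *ᵥ ·) (hv.recurrence hr hb (i := i + 1) hi)
  simp only [Matrix.mulVec_sub, Matrix.mulVec_add, Matrix.mulVec_smul] at h1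
  rw [dualIdem_mulVec_adjacency_eq_zero hr.connected hb (dualIdem_raised v (i + 1 + 1)) (by omega)
    (by omega), dualIdem_mulVec_of_ne (by omega) (dualIdem_raised v (i + 1 + 2)),
    dualIdem_mulVec_of_ne (by omega) (dualIdem_capped v (i + 1 + 2)),
    dualIdem_mulVec_of_ne (by omega) (dualIdem_raised v (i + 1)), dualIdem_capped] at h1
  simpa using h1

/-- The sphere-2 part of p_2(A)v = A_2 v + v is b_3 v by the local eigenvalue, and is -s_2 by
`act_p_eq`. This starts the induction of `IsLocalVector.scalars`. -/
theorem IsLocalVector.capped_two (hv : IsLocalVector G x v)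
    (hr : IsDistanceRegular G) (hb : G.IsBipartite) (hD : 3 ≤ G.diam) :
    capped G x v 2 = (upperScalar G 0 : ℂ) • raised G x v 0 := by
  have h1 := congrArg (dualIdem G x 2 *ᵥ ·)
    (act_p_eq hr hb (i := 2) (by omega) hv.dual_two hv.sum_eq_zero)
  simp only [Matrix.mulVec_sub] at h1
  rw [dualIdem_mulVec_of_ne (by omega) (dualIdem_raised v 2), dualIdem_capped, p_add_two, act_add,
    act_f hr hb (by omega), p_zero, act_one, Matrix.mulVec_add, hv.local_eigenvalue, hv.dual_two,
    zero_sub] at h1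
  rw [raised_zero hr.connected hv.dual_two, upperScalar_even hr hb (by omega) Even.zero,
    zero_add, zero_add, c_one hr (by omega), eq_comm, ← neg_inj, ← h1]
  push_cast
  module

/-- The three claims feed each other: a nonzero lower scalar keeps r_{i+1} nonzero, thinness then
makes s_{i+3} a multiple of it, the capped recurrence determines the multiple, and the raised
recurrence gives the next lower scalar. -/
theorem IsLocalVector.scalars (hv : IsLocalVector G x v) (hr : IsDistanceRegular G)
    (hb : G.IsBipartite) {i : ℕ} (hi : i + 3 ≤ G.diam) :
    dualIdem G x (i + 2) *ᵥ (distMatrix G 1 *ᵥ raised G x v (i + 1)) =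
      (lowerScalar G i : ℂ) • raised G x v i ∧
    capped G x v (i + 2) = (upperScalar G i : ℂ) • raised G x v i ∧
    raised G x v i ≠ 0 := by
  induction i with
  | zero =>
    have h2 := hv.capped_two hr hb hi
    have h1 := hv.dualIdem_recurrence hr hb (i := 0) (by omega)
    refine ⟨?_, h2, ?_⟩
    · rw [zero_add, zero_add] at *
      rw [hv.capped_one hr hb (by omega), h2] at h1
      simp only [Matrix.mulVec_zero, sub_zero] at h1
      rw [h1, lowerScalar]
      push_cast
      module
    · rw [raised_zero hr.connected hv.dual_two]
      exact hv.ne_zero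
  | succ i ih =>
    obtain ⟨h1, h2, h3⟩ := ih (by omega)
    have hlow : (lowerScalar G i : ℂ) ≠ 0 := by
      exact_mod_cast lowerScalar_ne_zero hr hb (by omega)
    have h4 : raised G x v (i + 1) ≠ 0 := by
      intro h
      rw [h, Matrix.mulVec_zero, Matrix.mulVec_zero, eq_comm, smul_eq_zero] at h1
      exact h1.elim hlow h3
    have h5 : capped G x v (i + 3) = (upperScalar G (i + 1) : ℂ) • raised G x v (i + 1) := by
      obtain ⟨s, hs⟩ := hv.exists_upper (i + 1) (by omega) h4
      have h6 := hv.dualIdem_recurrence_capped hr hb (i := i + 1) (by omega)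
      simp only [show i + 1 + 2 = i + 3 by ring, show i + 1 + 1 = i + 2 by ring,
        show i + 1 + 3 = i + 4 by ring] at hs h6
      -- With the unknown s this becomes s · `lowerScalar` i = b_{i+4} · `upperScalar` i, which has
      -- a unique solution.
      rw [hs, h2, Matrix.mulVec_smul, Matrix.mulVec_smul, h1, smul_smul, smul_smul] at h6
      have h7 := smul_left_injective ℂ h3 h6
      have h8 := upperScalar_mul_lowerScalar hr hb (i := i) (by omega)
      have h9 : (upperScalar G (i + 1) : ℂ) * lowerScalar G i = b G (i + 4) * upperScalar G i := by
        exact_mod_cast h8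
      rw [hs, mul_right_cancel₀ hlow (h7.trans h9.symm)]
    refine ⟨?_, h5, h4⟩
    have h6 := hv.dualIdem_recurrence hr hb (i := i + 1) (by omega)
    simp only [show i + 1 + 2 = i + 3 by ring, show i + 1 + 1 = i + 2 by ring] at h6 ⊢
    have h7 : dualIdem G x (i + 3) *ᵥ (distMatrix G 1 *ᵥ raised G x v i) =
        (c G (i + 1) : ℂ) • raised G x v (i + 1) := by
      cases i with
      | zero =>
        rw [hv.adjacency_raised_zero hr hb (by omega), zero_add, c_one hr (by omega)]
        simpa using dualIdem_raised v 1
      | succ i =>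
        rw [hv.adjacency_raised hr hb (by omega), Matrix.mulVec_add, Matrix.mulVec_smul,
          dualIdem_raised v (i + 2), dualIdem_mulVec_of_ne (by omega) (dualIdem_mulVec_self _ _),
          add_zero]
    rw [h2, Matrix.mulVec_smul, Matrix.mulVec_smul, h7, h5, sub_eq_iff_eq_add] at h6
    rw [h6, lowerScalar]
    push_cast
    module

theorem IsLocalVector.raised_ne_zero (hv : IsLocalVector G x v) (hr : IsDistanceRegular G)
    (hb : G.IsBipartite) {i : ℕ} (hi : i + 3 ≤ G.diam) : raised G x v i ≠ 0 :=
  (hv.scalars hr hb hi).2.2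

theorem IsLocalVector.adjacency_raised_eq (hv : IsLocalVector G x v) (hr : IsDistanceRegular G)
    (hb : G.IsBipartite) {i : ℕ} (hi : i + 3 ≤ G.diam) :
    distMatrix G 1 *ᵥ raised G x v (i + 1) = (c G (i + 2) : ℂ) • raised G x v (i + 2) +
      (lowerScalar G i : ℂ) • raised G x v i := by
  rw [hv.adjacency_raised hr hb (by omega), (hv.scalars hr hb hi).1]

theorem star_dotProduct_eq_zero {m n : ℕ} (h : m ≠ n) {u w : X → ℂ}
    (hu : dualIdem G x m *ᵥ u = u) (hw : dualIdem G x n *ᵥ w = w) : star u ⬝ᵥ w = 0 := by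
  refine Finset.sum_eq_zero fun y _ => ?_
  by_cases hy : G.dist x y = m
  · rw [apply_eq_zero_of_dualIdem hw (by omega), mul_zero]
  · rw [Pi.star_apply, apply_eq_zero_of_dualIdem hu hy, star_zero, zero_mul]

open scoped ComplexOrder in
-- As the lower scalar at D - 3 is 0, A r_{D-2} is orthogonal to r_{D-3}. Moving A across the inner
-- product gives c_{D-2}‖r_{D-2}‖² = 0.
theorem IsLocalVector.raised_last (hv : IsLocalVector G x v) (hr : IsDistanceRegular G)
    (hb : G.IsBipartite) (heven : Even G.diam) {i : ℕ} (hi : i + 4 = G.diam) :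
    raised G x v (i + 2) = 0 := by
  have h1 := hv.adjacency_raised_eq hr hb (i := i + 1) (by omega)
  rw [lowerScalar_eq_zero hr hb heven (by omega), Complex.ofReal_zero, zero_smul, add_zero] at h1
  have h2 := dotProduct_adjacency (G := G) (raised G x v (i + 2)) (raised G x v (i + 1))
  rw [h1, hv.adjacency_raised_eq hr hb (by omega), dotProduct_add, dotProduct_smul,
    dotProduct_smul, star_smul, smul_dotProduct,
    star_dotProduct_eq_zero (by omega) (dualIdem_raised v (i + 3)) (dualIdem_raised v (i + 1)),
    star_dotProduct_eq_zero (by omega) (dualIdem_raised v (i + 2)) (dualIdem_raised v i), smul_zero,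
    smul_zero, add_zero, eq_comm, smul_eq_zero] at h2
  have h3 : (c G (i + 2) : ℂ) ≠ 0 := by
    exact_mod_cast c_ne_zero hr (i := i + 1) (by omega)
  exact dotProduct_star_self_eq_zero.1 (h2.resolve_left h3)

theorem IsLocalVector.raised_eq_act_g (hv : IsLocalVector G x v) (hr : IsDistanceRegular G)
    (hb : G.IsBipartite) {i : ℕ} (hi : i + 3 ≤ G.diam) : raised G x v i = act G (g G i) v := by
  induction i using Nat.twoStepInduction with
  | zero => rw [g_zero hr (by omega), act_one, raised_zero hr.connected hv.dual_two]
  | one =>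
    rw [g_one hr hb (by omega), act_X, ← hv.adjacency_raised_zero hr hb (by omega),
      raised_zero hr.connected hv.dual_two]
  | more i ih _ =>
    rw [g_add_two hr hb (by omega), act_add, act_C_mul, ← ih (by omega),
      act_p_eq hr hb (by omega) hv.dual_two hv.sum_eq_zero,
      (hv.scalars hr hb (i := i) (by omega)).2.1]
    simp

/-- `v` lies in the image of `A`. -/
theorem IsLocalVector.exists_adjacency_mulVec_eq (hv : IsLocalVector G x v)
    (hr : IsDistanceRegular G) (hb : G.IsBipartite) (heven : Even G.diam) (hD : 4 ≤ G.diam) :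
    ∃ w, distMatrix G 1 *ᵥ w = v := by
  have key : ∀ n i, Even i → i + 2 * n + 4 = G.diam →
      ∃ w, distMatrix G 1 *ᵥ w = raised G x v i := by
    intro n
    induction n with
    | zero =>
      intro i _ hi
      have h1 := hv.adjacency_raised_eq hr hb (i := i) (by omega)
      rw [hv.raised_last hr hb heven (by omega), smul_zero, zero_add] at h1
      have h2 : (lowerScalar G i : ℂ) ≠ 0 := by
        exact_mod_cast lowerScalar_ne_zero hr hb (by omega)
      exact ⟨(lowerScalar G i : ℂ)⁻¹ • raised G x v (i + 1), by
        rw [Matrix.mulVec_smul, h1, inv_smul_smul₀ h2]⟩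
    | succ n ih =>
      intro i hi hin
      obtain ⟨w, hw⟩ := ih (i + 2) (by grind) (by omega)
      have h1 := hv.adjacency_raised_eq hr hb (i := i) (by omega)
      have h2 : (lowerScalar G i : ℂ) ≠ 0 := by
        exact_mod_cast lowerScalar_ne_zero hr hb (by omega)
      refine ⟨(lowerScalar G i : ℂ)⁻¹ • (raised G x v (i + 1) - (c G (i + 2) : ℂ) • w), ?_⟩
      rw [Matrix.mulVec_smul, Matrix.mulVec_sub, Matrix.mulVec_smul, hw, h1, add_sub_cancel_left,
        inv_smul_smul₀ h2]
  obtain ⟨m, hm⟩ := heven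
  -- Here D = 2m, so m - 2 double steps lead from index 0 to the top even index D - 4.
  obtain ⟨w, hw⟩ := key (m - 2) 0 Even.zero (by omega)
  exact ⟨w, by rw [hw, raised_zero hr.connected hv.dual_two]⟩

/-- Both terms of `act_p_eq` at i = D involve distance D + 2, which does not occur. -/
theorem IsLocalVector.act_p_diam (hv : IsLocalVector G x v) (hr : IsDistanceRegular G)
    (hb : G.IsBipartite) : act G (p G G.diam) v = 0 := by
  rw [act_p_eq hr hb le_rfl hv.dual_two hv.sum_eq_zero, capped,
    distMatrix_eq_zero hr.connected (by omega)]
  ext y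
  have := dist_le_of_diam hr.connected x y
  simp only [raised, Matrix.zero_mulVec, Matrix.mulVec_zero, sub_zero, Pi.zero_apply,
    dualIdem_mulVec_apply, ite_eq_right_iff]
  omega

theorem IsLocalVector.primIdem_zero (hv : IsLocalVector G x v) (hr : IsDistanceRegular G)
    (hb : G.IsBipartite) (hD : 1 ≤ G.diam) : primIdem G 0 *ᵥ v = 0 := by
  refine primIdem_mulVec_eq_zero_of_act (hv.act_p_diam hr hb) ?_
  rw [theta_zero hr hb hD]
  exact (p_eval_valency_pos hr hb le_rfl).ne'

theorem IsLocalVector.primIdem_diam (hv : IsLocalVector G x v) (hr : IsDistanceRegular G)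
    (hb : G.IsBipartite) (heven : Even G.diam) (hD : 1 ≤ G.diam) :
    primIdem G G.diam *ᵥ v = 0 := by
  refine primIdem_mulVec_eq_zero_of_act (hv.act_p_diam hr hb) ?_
  rw [theta_diam hr hb hD, p_eval_neg heven]
  exact (p_eval_valency_pos hr hb le_rfl).ne'

theorem IsLocalVector.primIdem_half (hv : IsLocalVector G x v) (hr : IsDistanceRegular G)
    (hb : G.IsBipartite) (hD : 4 ≤ G.diam) {d : ℕ} (hd : G.diam = 2 * d) :
    primIdem G d *ᵥ v = 0 := by
  obtain ⟨w, rfl⟩ := hv.exists_adjacency_mulVec_eq hr hb (by simp [hd]) hD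
  exact primIdem_mulVec_adjacency_eq_zero (theta_half hr hb (by omega) hd) w

theorem IsLocalVector.act_eq_sum (hv : IsLocalVector G x v) (hr : IsDistanceRegular G)
    (hb : G.IsBipartite) (hD : 4 ≤ G.diam) {d : ℕ} (hd : G.diam = 2 * d) (q : ℝ[X]) :
    act G q v = ∑ j ∈ (Finset.Icc 1 (G.diam - 1)).erase d,
      ((q.eval (theta G j) : ℝ) : ℂ) • (primIdem G j *ᵥ v) := by
  conv_lhs => rw [← sum_primIdem hr hb (by omega) v, act_vec_sum]
  rw [Finset.sum_congr rfl fun j _ => act_eigenvector (adjacency_mulVec_primIdem j v) q]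
  symm
  refine Finset.sum_subset (fun j hj => ?_) fun j hj hj' => ?_
  · simp only [Finset.mem_erase, Finset.mem_Icc, Finset.mem_range] at *
    omega
  · simp only [Finset.mem_erase, Finset.mem_Icc, Finset.mem_range] at *
    have h : j = 0 ∨ j = d ∨ j = G.diam := by omega
    rcases h with rfl | rfl | rfl
    · rw [hv.primIdem_zero hr hb (by omega), smul_zero]
    · rw [hv.primIdem_half hr hb hD hd, smul_zero]
    · rw [hv.primIdem_diam hr hb (by simp [hd]) (by omega), smul_zero]

theorem IsLocalVector.raised_eq_sum (hv : IsLocalVector G x v) (hr : IsDistanceRegular G)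
    (hb : G.IsBipartite) (hD : 4 ≤ G.diam) {d : ℕ} (hd : G.diam = 2 * d) {i : ℕ}
    (hi : i + 3 ≤ G.diam) :
    raised G x v i = ∑ j ∈ (Finset.Icc 1 (G.diam - 1)).erase d,
      (((g G i).eval (theta G j) : ℝ) : ℂ) • (primIdem G j *ᵥ v) := by
  rw [hv.raised_eq_act_g hr hb hi, hv.act_eq_sum hr hb hD hd]

theorem IsLocalVector.linearIndependent_raised (hv : IsLocalVector G x v)
    (hr : IsDistanceRegular G) (hb : G.IsBipartite) :
    LinearIndependent ℂ fun i : Fin (G.diam - 2) => raised G x v i := by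
  rw [Fintype.linearIndependent_iff]
  intro a ha i
  have h := congrArg (dualIdem G x ((i : ℕ) + 2) *ᵥ ·) ha
  simp only [Matrix.mulVec_sum, Matrix.mulVec_smul, Matrix.mulVec_zero] at h
  rw [Finset.sum_eq_single i, dualIdem_raised, smul_eq_zero] at h
  · exact h.resolve_right (hv.raised_ne_zero hr hb (by omega))
  · intro j _ hj
    rw [dualIdem_mulVec_of_ne (n := (j : ℕ) + 2) _ (dualIdem_raised v j), smul_zero]
    intro h'
    exact hj (Fin.ext (by omega))
  · simp

/-- The span of the vectors `E*_{i+2}A_iv` is `A`-invariant. -/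
theorem IsLocalVector.adjacency_mem_span (hv : IsLocalVector G x v)
    (hr : IsDistanceRegular G) (hb : G.IsBipartite) (heven : Even G.diam) (hD : 4 ≤ G.diam)
    (i : Fin (G.diam - 2)) :
    distMatrix G 1 *ᵥ raised G x v i ∈
      Submodule.span ℂ (Set.range fun i : Fin (G.diam - 2) => raised G x v i) := by
  have hmem : ∀ j, j + 2 ≤ G.diam → raised G x v j ∈
      Submodule.span ℂ (Set.range fun i : Fin (G.diam - 2) => raised G x v i) := by
    intro j hj
    by_cases h : j + 2 = G.diam
    · obtain ⟨m, rfl⟩ : ∃ m, j = m + 2 := ⟨j - 2, by omega⟩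
      rw [hv.raised_last hr hb heven (by omega)]
      exact zero_mem _
    · exact Submodule.subset_span ⟨⟨j, by omega⟩, rfl⟩
  obtain ⟨i, hi⟩ := i
  cases i with
  | zero =>
    simp only
    rw [hv.adjacency_raised_zero hr hb (by omega)]
    exact hmem 1 (by omega)
  | succ i =>
    simp only
    rw [hv.adjacency_raised_eq hr hb (by omega)]
    exact add_mem (Submodule.smul_mem _ _ (hmem _ (by omega)))
      (Submodule.smul_mem _ _ (hmem _ (by omega)))

end LocalVectors

/-! ### From the module W to local vectors, and the two bases. -/

section Modules

variable {X : Type*} [Fintype X] [DecidableEq X] {G : SimpleGraph X} {x : X}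
  {W : Submodule ℂ (X → ℂ)}

theorem isTModule_of_generators (hA : ∀ w ∈ W, distMatrix G 1 *ᵥ w ∈ W)
    (hE : ∀ i, ∀ w ∈ W, dualIdem G x i *ᵥ w ∈ W) : IsTModule G x W := by
  intro B hB
  induction hB using Algebra.adjoin_induction with
  | mem B hB =>
    rcases hB with rfl | ⟨i, rfl⟩
    · exact hA
    · exact hE i
  | algebraMap r =>
    intro w hw
    rw [Algebra.algebraMap_eq_smul_one, Matrix.smul_mulVec, Matrix.one_mulVec]
    exact W.smul_mem _ hw
  | add B C _ _ hB hC =>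
    intro w hw
    rw [Matrix.add_mulVec]
    exact add_mem (hB w hw) (hC w hw)
  | mul B C _ _ hB hC =>
    intro w hw
    rw [← Matrix.mulVec_mulVec]
    exact hB _ (hC w hw)

theorem IsTModule.adjacency_mem (h : IsTModule G x W) {w : X → ℂ} (hw : w ∈ W) :
    distMatrix G 1 *ᵥ w ∈ W :=
  h _ (Algebra.subset_adjoin (Set.mem_insert _ _)) w hw

theorem IsTModule.dualIdem_mem (h : IsTModule G x W) (i : ℕ) {w : X → ℂ} (hw : w ∈ W) :
    dualIdem G x i *ᵥ w ∈ W :=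
  h _ (Algebra.subset_adjoin (Set.mem_insert_of_mem _ ⟨i, rfl⟩)) w hw

theorem IsTModule.act_mem (h : IsTModule G x W) (q : ℝ[X]) {w : X → ℂ} (hw : w ∈ W) :
    act G q w ∈ W := by
  induction q using Polynomial.induction_on' with
  | add q r hq hr => rw [act_add]; exact add_mem hq hr
  | monomial n a =>
    rw [← Polynomial.C_mul_X_pow_eq_monomial, act_C_mul]
    refine W.smul_mem _ ?_
    induction n with
    | zero => rwa [pow_zero, act_one]
    | succ n ih => rw [pow_succ', act_X_mul]; exact h.adjacency_mem ih

theorem IsTModule.distMatrix_mem (h : IsTModule G x W) (hr : IsDistanceRegular G)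
    (hb : G.IsBipartite) (i : ℕ) {w : X → ℂ} (hw : w ∈ W) : distMatrix G i *ᵥ w ∈ W := by
  by_cases hi : i ≤ G.diam
  · rw [← act_f hr hb hi]
    exact h.act_mem _ hw
  · rw [distMatrix_eq_zero hr.connected (by omega), Matrix.zero_mulVec]
    exact W.zero_mem

theorem dualIdem_mem_dualComponent (i : ℕ) {w : X → ℂ} (hw : w ∈ W) :
    dualIdem G x i *ᵥ w ∈ dualComponent G x W i :=
  Submodule.mem_map_of_mem (f := (dualIdem G x i).mulVecLin) hw

theorem dualIdem_of_mem_dualComponent {i : ℕ} {w : X → ℂ} (hw : w ∈ dualComponent G x W i) :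
    dualIdem G x i *ᵥ w = w := by
  obtain ⟨u, -, rfl⟩ := hw
  exact dualIdem_mulVec_self _ _

theorem dualComponent_eq_bot {i : ℕ} (hi : i ≤ G.diam) (h : i < endpoint G x W) :
    dualComponent G x W i = ⊥ := by
  by_contra h'
  exact Nat.notMem_of_lt_sInf h ⟨hi, h'⟩

theorem IsThin.exists_smul_eq (h : IsThin G x W) {i : ℕ} (hi : i ≤ G.diam) {u w : X → ℂ}
    (hu : u ∈ dualComponent G x W i) (hw : w ∈ dualComponent G x W i) (hu0 : u ≠ 0) :
    ∃ s : ℂ, w = s • u := by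
  have h1 := finrank_le_one_iff.1 (h i hi)
  obtain ⟨z, hz⟩ := h1
  obtain ⟨s, hs⟩ := hz ⟨u, hu⟩
  obtain ⟨t, ht⟩ := hz ⟨w, hw⟩
  have hs' : s • (z : X → ℂ) = u := congrArg Subtype.val hs
  have ht' : t • (z : X → ℂ) = w := congrArg Subtype.val ht
  have hs0 : s ≠ 0 := by
    rintro rfl
    exact hu0 (by rw [← hs', zero_smul])
  exact ⟨t * s⁻¹, by rw [← hs', ← ht', smul_smul, inv_mul_cancel_right₀ hs0]⟩

theorem isLocalVector_of_mem (hr : IsDistanceRegular G) (hb : G.IsBipartite) (hD : 4 ≤ G.diam)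
    {d : ℕ} (hd : G.diam = 2 * d) (hW : IsTModule G x W) (hthin : IsThin G x W)
    (hend : endpoint G x W = 2) (hη : HasLocalEigenvalue G x W (tilde G (theta G d)))
    {v : X → ℂ} (hv : v ∈ dualComponent G x W 2) (hv0 : v ≠ 0) : IsLocalVector G x v := by
  have hv2 := dualIdem_of_mem_dualComponent hv
  have hvW : v ∈ W := by
    obtain ⟨u, hu, rfl⟩ := hv
    exact hW.dualIdem_mem 2 hu
  have hr_mem : ∀ i, raised G x v i ∈ dualComponent G x W (i + 2) := fun i =>
    dualIdem_mem_dualComponent _ (hW.distMatrix_mem hr hb i hvW)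
  have hzero : ∀ i < 2, ∀ w ∈ W, dualIdem G x i *ᵥ w = 0 := by
    intro i hi w hw
    have h := dualIdem_mem_dualComponent (G := G) (x := x) i hw
    rwa [dualComponent_eq_bot (by omega) (by omega), Submodule.mem_bot] at h
  refine ⟨hv0, hv2, ?_, hzero 1 (by omega) _ (hW.adjacency_mem hvW), ?_, ?_, ?_⟩
  -- The entry of E*_0 A_2 v at x is the sum of v over the sphere of radius 2, which is its whole
  -- support.
  · have h := congrFun (hzero 0 (by omega) _ (hW.distMatrix_mem hr hb 2 hvW)) x
    rw [dualIdem_mulVec_apply, if_pos SimpleGraph.dist_self, distMatrix_mulVec_apply] at h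
    rw [Pi.zero_apply] at h
    rw [← h]
    refine Finset.sum_congr rfl fun z _ => ?_
    split_ifs with hz
    · rfl
    · exact apply_eq_zero_of_dualIdem hv2 hz
  · have h := hη v hv
    rw [← Matrix.mulVec_mulVec, ← Matrix.mulVec_mulVec, hv2] at h
    rw [h, tilde, theta_half hr hb (by omega) hd]
    have h2 := b_ne_zero hr (i := 2) (by omega)
    congr 1
    have : -1 - ((b G 2 : ℝ) * b G 3) / ((0 : ℝ) ^ 2 - b G 2) = b G 3 - 1 := by
      rw [zero_pow two_ne_zero, zero_sub, div_neg, mul_div_cancel_left₀ _ h2]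
      ring
    rw [this]
    push_cast
    rfl
  · intro i hi h0
    exact hthin.exists_smul_eq hi (hr_mem i)
      (dualIdem_mem_dualComponent _ (hW.distMatrix_mem hr hb _ hvW)) h0
  · intro i hi h0
    exact hthin.exists_smul_eq hi (hr_mem i)
      (dualIdem_mem_dualComponent _ (hW.adjacency_mem
        (hW.dualIdem_mem _ (hW.distMatrix_mem hr hb _ hvW)))) h0

/-- The span is a nonzero T-submodule of W, since it is invariant under the generators A and E*_n;
irreducibility leaves only W. -/
theorem span_raised_eq (hr : IsDistanceRegular G) (hb : G.IsBipartite) (hD : 4 ≤ G.diam)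
    (heven : Even G.diam) (hirr : IsIrredTModule G x W) {v : X → ℂ} (hv : IsLocalVector G x v)
    (hvW : v ∈ W) :
    Submodule.span ℂ (Set.range fun i : Fin (G.diam - 2) => raised G x v i) = W := by
  refine (hirr.eq_bot_or_eq _ (isTModule_of_generators ?_ ?_) ?_).resolve_left ?_
  · intro w hw
    induction hw using Submodule.span_induction with
    | mem w hw =>
      obtain ⟨i, rfl⟩ := hw
      exact hv.adjacency_mem_span hr hb heven hD i
    | zero => rw [Matrix.mulVec_zero]; exact zero_mem _
    | add w u _ _ hw hu => rw [Matrix.mulVec_add]; exact add_mem hw hu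
    | smul a w _ hw => rw [Matrix.mulVec_smul]; exact Submodule.smul_mem _ _ hw
  · intro n w hw
    induction hw using Submodule.span_induction with
    | mem w hw =>
      obtain ⟨i, rfl⟩ := hw
      by_cases h : n = (i : ℕ) + 2
      · subst h
        simp only [dualIdem_raised]
        exact Submodule.subset_span ⟨i, rfl⟩
      · rw [dualIdem_mulVec_of_ne h (dualIdem_raised v i)]
        exact zero_mem _
    | zero => rw [Matrix.mulVec_zero]; exact zero_mem _
    | add w u _ _ hw hu => rw [Matrix.mulVec_add]; exact add_mem hw hu
    | smul a w _ hw => rw [Matrix.mulVec_smul]; exact Submodule.smul_mem _ _ hw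
  · rw [Submodule.span_le]
    rintro _ ⟨i, rfl⟩
    exact hirr.isTModule.dualIdem_mem _ (hirr.isTModule.distMatrix_mem hr hb _ hvW)
  · intro h
    have h1 : raised G x v 0 ∈
        Submodule.span ℂ (Set.range fun i : Fin (G.diam - 2) => raised G x v i) :=
      Submodule.subset_span ⟨⟨0, by omega⟩, rfl⟩
    rw [h, Submodule.mem_bot] at h1
    exact hv.raised_ne_zero hr hb (by omega) h1

/-- Two spanning families of the same finite size, the first one linearly independent and
expanded in terms of the second one, are bases with the given transition matrix. -/
theorem exists_bases_of_expansion {ι κ V : Type*} [Fintype ι] [Fintype κ] [AddCommGroup V]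
    [Module ℂ V] {W : Submodule ℂ V} {s : ι → V} {e : κ → V} (a : κ → ι → ℂ)
    (hcard : Fintype.card ι = Fintype.card κ) (hs : LinearIndependent ℂ s)
    (hW : Submodule.span ℂ (Set.range s) = W) (hse : ∀ i, s i = ∑ j, a j i • e j) :
    ∃ (bE : Module.Basis κ ℂ W) (bS : Module.Basis ι ℂ W),
      (∀ j, (bE j : V) = e j) ∧ (∀ i, (bS i : V) = s i) ∧ bE.toMatrix bS = Matrix.of a := by
  subst hW
  set W := Submodule.span ℂ (Set.range s) with hW
  have hfin : Module.finrank ℂ W = Fintype.card κ := by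
    rw [hW, finrank_span_eq_card hs, hcard]
  have hle : W ≤ Submodule.span ℂ (Set.range e) := by
    rw [hW, Submodule.span_le]
    rintro _ ⟨i, rfl⟩
    rw [SetLike.mem_coe, hse]
    exact sum_mem fun j _ => Submodule.smul_mem _ _ (Submodule.subset_span ⟨j, rfl⟩)
  have : FiniteDimensional ℂ (Submodule.span ℂ (Set.range e)) :=
    FiniteDimensional.span_of_finite ℂ (Set.finite_range e)
  -- W lies in the span of e and has dimension card κ, the largest that span can have; equality
  -- follows, and with it the independence of e.
  have heq : W = Submodule.span ℂ (Set.range e) :=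
    Submodule.eq_of_le_of_finrank_le hle (by rw [hfin]; exact finrank_range_le_card e)
  have he : LinearIndependent ℂ e :=
    linearIndependent_iff_card_eq_finrank_span.2 (by rw [Set.finrank, ← heq, hfin])
  let bE : Module.Basis κ ℂ W := (Module.Basis.span he).map (LinearEquiv.ofEq _ _ heq.symm)
  let bS : Module.Basis ι ℂ W := Module.Basis.span hs
  have hbE : ∀ j, (bE j : V) = e j := fun j => by simp [bE, Module.Basis.span_apply]
  have hbS : ∀ i, (bS i : V) = s i := fun i => by
    rw [Module.Basis.span_apply hs i]
  refine ⟨bE, bS, hbE, hbS, ?_⟩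
  ext j i
  have h : bS i = ∑ j, a j i • bE j := by
    apply Subtype.ext
    simp [hbS, hbE, hse]
  classical
  rw [Module.Basis.toMatrix_apply, h, Module.Basis.repr_sum_self, Matrix.of_apply]

end Modules

end DRG

/-! ### The main theorem. -/

theorem theorem14 {X : Type*} [Fintype X] [DecidableEq X] (G : SimpleGraph X) (D d : ℕ)
    (hG : DRG.IsDistanceRegular G) (hbip : G.IsBipartite)
    (hdiam : G.diam = D) (hD : 4 ≤ D) (hk : 3 ≤ DRG.b G 0)
    (heven : Even D) (hd : d = D / 2)
    (x : X) (W : Submodule ℂ (X → ℂ))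
    (hirr : DRG.IsIrredTModule G x W) (hthin : DRG.IsThin G x W)
    (hend : DRG.endpoint G x W = 2)
    (hη : DRG.HasLocalEigenvalue G x W (DRG.tilde G (DRG.theta G d)))
    (v : X → ℂ) (hv : v ∈ DRG.dualComponent G x W 2) (hv0 : v ≠ 0) :
    -- the denominators in the definition of the `g_i` are nonzero
    (∀ i ≤ D - 3, (DRG.P G i).eval 0 ≠ 0 ∧
      (DRG.kk G i : ℝ) * DRG.b G i * DRG.b G (i + 1) ≠ 0) ∧
    -- the expansion
    (∀ i ≤ D - 3,
      (DRG.dualIdem G x (i + 2) * DRG.distMatrix G i) *ᵥ v =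
        ∑ j ∈ (Finset.Icc 1 (D - 1)).erase d,
          (((DRG.g G i).eval (DRG.theta G j) : ℝ) : ℂ) • (DRG.primIdem G j *ᵥ v)) ∧
    -- both families are bases of `W`, with transition matrix `(g_i(θ_j))`
    (∃ (bE : Module.Basis ↥((Finset.Icc 1 (D - 1)).erase d) ℂ W)
       (bS : Module.Basis (Fin (D - 2)) ℂ W),
      (∀ j, ((bE j : W) : X → ℂ) = DRG.primIdem G j *ᵥ v) ∧
      (∀ i, ((bS i : W) : X → ℂ) =
        (DRG.dualIdem G x ((i : ℕ) + 2) * DRG.distMatrix G (i : ℕ)) *ᵥ v) ∧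
      bE.toMatrix bS =
        Matrix.of fun (j : ↥((Finset.Icc 1 (D - 1)).erase d)) (i : Fin (D - 2)) =>
          (((DRG.g G i).eval (DRG.theta G j) : ℝ) : ℂ)) := by
  subst hdiam
  have hd2 : G.diam = 2 * d := by
    obtain ⟨m, hm⟩ := heven
    omega
  have hloc := DRG.isLocalVector_of_mem hG hbip hD hd2 hirr.isTModule hthin hend hη hv hv0
  have hvW : v ∈ W := by
    obtain ⟨u, hu, rfl⟩ := hv
    exact hirr.isTModule.dualIdem_mem 2 hu
  have hraised : ∀ i, (DRG.dualIdem G x (i + 2) * DRG.distMatrix G i) *ᵥ v =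
      DRG.raised G x v i := fun i => by rw [DRG.raised, Matrix.mulVec_mulVec]
  have hexp : ∀ i ≤ G.diam - 3, DRG.raised G x v i =
      ∑ j ∈ (Finset.Icc 1 (G.diam - 1)).erase d,
        (((DRG.g G i).eval (DRG.theta G j) : ℝ) : ℂ) • (DRG.primIdem G j *ᵥ v) :=
    fun i hi => hloc.raised_eq_sum hG hbip hD hd2 (by omega)
  refine ⟨fun i hi => ⟨DRG.P_eval_zero_ne_zero hG hbip (by omega),
    DRG.valencyProduct_ne_zero hG (by omega)⟩, fun i hi => by rw [hraised, hexp i hi], ?_⟩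
  simp only [hraised]
  refine DRG.exists_bases_of_expansion (e := fun j : ↥((Finset.Icc 1 (G.diam - 1)).erase d) =>
    DRG.primIdem G j *ᵥ v) _ ?_ (hloc.linearIndependent_raised hG hbip)
    (DRG.span_raised_eq hG hbip hD heven hirr hloc hvW) fun i => ?_
  -- Removing d from the D - 1 indices 1, ..., D - 1 leaves D - 2, the number of raised vectors.
  · rw [Fintype.card_fin, Fintype.card_coe, Finset.card_erase_of_mem, Nat.card_Icc]
    · omega
    · rw [Finset.mem_Icc]; omega
  · rw [hexp i (by omega), ← Finset.sum_coe_sort]
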